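/- Let $\lambda>0$ and $p\in(0,1)$. Let $N\sim\mathrm{Poisson}(\lambda)$, and let $X_1,X_2,\dots$ be i.i.d., independent of $N$, with the negative binomial distribution $\mathrm{NBin}(\tfrac12,p)$, i.e. $\mathbb P[X_i=n]=\binom{\frac12+n-1}{n}p^{1/2}(1-p)^n$ for $n\ge 0$. Put $L=X_1+\dots+X_N$ and $a_n=\mathbb P[L=n]$, $n\ge 0$. Call the computation of a sequence $(a_n)$ by a linear recurrence $R_0(n)c_n+\dots+R_e(n)c_{n+e}=0$ $(n\ge 0)$ numerically stable if $R_e(n)\neq 0$ for all $n\ge 0$, $(a_n)$ is a solution, and $(a_n)$ grows at least as fast as any other solution, i.e. $c_n=O(a_n)$ as $n\to\infty$ for every real solution $(c_n)$. Then: 1. The computation of $(a_n)$ by the third-order recurrence \[ 2n(2n+1)(1-p)^3 a_n-(1-p)^2\bigl(-\lambda^2p+12n^2+24n+12\bigr)a_{n+1}+6(n+2)(2n+3)(1-p)a_{n+2}=4(n+2)(n+3)a_{n+3},\qquad n\ge 0, \] is numerically stable. 2. As $n\to\infty$, \[ a_n\sim\frac{\lambda^{1/3}p^{1/6}}{2^{1/3}\sqrt{3\pi}}\,(1-p)^n\,n^{-5/6}\exp\bigl(3p^{1/3}(\lambda/2)^{2/3}n^{1/3}-\lambda\bigr).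 \] 3. If $b_n$ denotes the $n$-th Taylor coefficient at $z=0$ of $\exp\Bigl(-\lambda\sqrt{p/(1-(1-p)z)}\Bigr)$ (for $\lambda=1$, $p=\tfrac12$ this function is $\exp(-1/\sqrt{2-z})$), then $b_n=o(a_n)$ as $n\to\infty$. -/

import Mathlib

open MeasureTheory ProbabilityTheory Filter Topology Asymptotics
open scoped NNReal

/-- The negative binomial distribution `NBin(α, p)` on `ℕ`: the mass at `n` is
`(α + n - 1 choose n) * p ^ α * (1 - p) ^ n`, with the generalized binomial coefficient
`(x choose n) = x (x - 1) ⋯ (x - n + 1) / n!` for real `x`. -/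
noncomputable def negBinMeasure (α p : ℝ) : Measure ℕ :=
  Measure.sum fun n : ℕ =>
    ENNReal.ofReal (Ring.choose (α + n - 1) n * p ^ α * (1 - p) ^ n) • Measure.dirac n

/-- The mass function of `NBin(α, p)` sums to one. -/
theorem hasSum_negBin {α p : ℝ} (hp : 0 < p) (hp1 : p < 1) :
    HasSum (fun n : ℕ => Ring.choose (α + n - 1) n * p ^ α * (1 - p) ^ n) 1 := by
  have h := Real.one_div_one_sub_rpow_hasFPowerSeriesOnBall_zero α
  have hmem : (1 - p : ℝ) ∈ Metric.eball (0 : ℝ) 1 := by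
    rw [Metric.mem_eball, edist_dist, Real.dist_eq, sub_zero, abs_of_pos (by linarith)]
    exact ENNReal.ofReal_lt_one.2 (by linarith)
  have h2 := (h.hasSum hmem).mul_left (p ^ α)
  have hpos := Real.rpow_pos_of_pos hp α
  have e1 : p ^ α * (1 / (1 - (0 + (1 - p))) ^ α) = 1 := by
    rw [show (1 - (0 + (1 - p)) : ℝ) = p by ring]
    field_simp
  rw [e1] at h2
  have e2 : (fun n : ℕ => Ring.choose (α + n - 1) n * p ^ α * (1 - p) ^ n) = fun n : ℕ =>
      p ^ α * (FormalMultilinearSeries.ofScalars ℝ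
        (fun n : ℕ => Ring.choose (α + n - 1) n) n) fun _ => 1 - p := by
    funext n
    rw [FormalMultilinearSeries.ofScalars_apply_eq, smul_eq_mul]
    ring
  rw [e2]
  exact h2

/-- The random sum `L = X₁ + ⋯ + X_N` (the claims are indexed from `0`). -/
def aggregateLoss {Ω : Type*} (N : Ω → ℕ) (X : ℕ → Ω → ℕ) (ω : Ω) : ℕ :=
  ∑ i ∈ Finset.range (N ω), X i ω

/-- `c` solves the linear recurrence
`R₀(n) c_n + R₁(n) c_{n+1} + ⋯ + R_e(n) c_{n+e} = 0` for all `n ≥ 0`. -/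
def SolvesRecurrence {e : ℕ} (R : Fin (e + 1) → ℕ → ℝ) (c : ℕ → ℝ) : Prop :=
  ∀ n : ℕ, ∑ k : Fin (e + 1), R k n * c (n + k) = 0

/-- The computation of the sequence `a` by the recurrence with coefficients `R` is numerically
stable: the recurrence can be solved for its highest term, `a` is a solution, and `a` grows at
least as fast as any other solution. -/
def IsNumericallyStable {e : ℕ} (R : Fin (e + 1) → ℕ → ℝ) (a : ℕ → ℝ) : Prop :=
  (∀ n : ℕ, R (Fin.last e) n ≠ 0) ∧ SolvesRecurrence R a ∧
    ∀ c : ℕ → ℝ, SolvesRecurrence R c → c =O[atTop] a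

/-- The coefficients of the third order recurrence
`2n(2n+1)(1-p)³ a_n - (1-p)²(-λ²p+12n²+24n+12) a_{n+1} + 6(n+2)(2n+3)(1-p) a_{n+2}
  = 4(n+2)(n+3) a_{n+3}`, with all terms on the left-hand side. -/
def poissonNegBinCoeff (lam p : ℝ) : Fin 4 → ℕ → ℝ :=
  ![fun n => 2 * n * (2 * n + 1) * (1 - p) ^ 3,
    fun n => -((1 - p) ^ 2 * (-lam ^ 2 * p + 12 * n ^ 2 + 24 * n + 12)),
    fun n => 6 * (n + 2) * (2 * n + 3) * (1 - p),
    fun n => -(4 * (n + 2) * (n + 3))]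

/-- The `n`-th coefficient of the Taylor series of `f` at `0`. -/
noncomputable def taylorCoeffZero (f : ℝ → ℝ) (n : ℕ) : ℝ :=
  iteratedDeriv n f 0 / n.factorial

/-! Put `q = 1 - p`, `x = λ√p`, and let `φ_n(s)` (`expInvSqrtCoeff`) be the coefficients of `Φ_s(w)
= exp (s (1 - w)^(-1/2))`. Conditioning on `N` shows that `L` has generating function `e^(-λ)
Φ_x(qz)`, so `a_n = e^(-λ) q^n φ_n(x)` (`measureReal_aggregateLoss_eq`), and likewise `b_n = q^n
φ_n(-x)`. Everything reduces to the growth of `φ_n(x)` and `φ_n(-x)`.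

`Φ_s` satisfies a second-order linear ODE in which `s` enters only through `s²`; comparing
coefficients gives the recurrence (`expInvSqrtCoeff_recurrence`), so `q^n φ_n(x)` and `q^n φ_n(-x)`
both solve it. The unit mass at index `0` is a third solution, because the lowest coefficient
vanishes at `n = 0`. These three span all solutions (`solution_eq_combination`).

On the unit disc `(1 - w)^(-1/2)` has nonnegative real part, so `|Φ_{-x}| ≤ 1`, and Cauchy's
estimate gives `|φ_n(-x)| ≤ 1`. For `φ_n(x)` the saddle point method applies on the circle of radius
`1 - y^4`, where `2 n y^6 = x`: after the rescaling `θ = y^5 t` the integrand tends to `exp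
(-3xt²/8)` (`tendsto_saddleIntegrand`) and is dominated by a multiple of `1/(1 + t²)`
(`norm_saddleIntegrand_le`). This yields `expInvSqrtCoeff_isEquivalent`, hence `φ_n(x) → ∞` and
`φ_n(-x) = o(φ_n(x))`, which gives stability and the last claim. -/

/-! ### Taylor coefficients -/

/-- The `n`-th Taylor coefficient at `0` of a complex function. -/
noncomputable def complexTaylorCoeff (f : ℂ → ℂ) (n : ℕ) : ℂ :=
  iteratedDeriv n f 0 / n.factorial

theorem complexTaylorCoeff_congr {f g : ℂ → ℂ} (h : f =ᶠ[𝓝 0] g) (n : ℕ) :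
    complexTaylorCoeff f n = complexTaylorCoeff g n := by
  rw [complexTaylorCoeff, complexTaylorCoeff, h.iteratedDeriv_eq]

theorem complexTaylorCoeff_zero (f : ℂ → ℂ) : complexTaylorCoeff f 0 = f 0 := by
  simp [complexTaylorCoeff]

theorem complexTaylorCoeff_deriv (f : ℂ → ℂ) (n : ℕ) :
    complexTaylorCoeff (deriv f) n = (n + 1) * complexTaylorCoeff f (n + 1) := by
  have h : (n.factorial : ℂ) ≠ 0 := mod_cast n.factorial_ne_zero
  have h' : (n + 1 : ℂ) ≠ 0 := mod_cast n.succ_ne_zero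
  rw [complexTaylorCoeff, complexTaylorCoeff, ← iteratedDeriv_succ', Nat.factorial_succ]
  push_cast
  field_simp

theorem complexTaylorCoeff_const_mul (a : ℂ) (f : ℂ → ℂ) (n : ℕ) :
    complexTaylorCoeff (fun w => a * f w) n = a * complexTaylorCoeff f n := by
  rw [complexTaylorCoeff, complexTaylorCoeff, iteratedDeriv_const_mul_field, mul_div_assoc]

theorem complexTaylorCoeff_sub {f g : ℂ → ℂ} (hf : AnalyticAt ℂ f 0) (hg : AnalyticAt ℂ g 0)
    (n : ℕ) : complexTaylorCoeff (fun w => f w - g w) n =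
      complexTaylorCoeff f n - complexTaylorCoeff g n := by
  rw [complexTaylorCoeff, complexTaylorCoeff, complexTaylorCoeff,
    iteratedDeriv_fun_sub hf.contDiffAt hg.contDiffAt, sub_div]

theorem iteratedDeriv_one_sub (i : ℕ) :
    iteratedDeriv i (fun w : ℂ => 1 - w) 0 = if i = 0 then 1 else if i = 1 then -1 else 0 := by
  rcases i with _ | i
  · simp
  · have : deriv (fun w : ℂ => 1 - w) = fun _ => -1 := by
      funext w
      simp
    rw [iteratedDeriv_succ', this, iteratedDeriv_const]
    simp

theorem complexTaylorCoeff_one_sub_mul {g : ℂ → ℂ} (hg : AnalyticAt ℂ g 0) (n : ℕ) :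
    complexTaylorCoeff (fun w => (1 - w) * g w) (n + 1) =
      complexTaylorCoeff g (n + 1) - complexTaylorCoeff g n := by
  have h : (n.factorial : ℂ) ≠ 0 := mod_cast n.factorial_ne_zero
  have h' : (n + 1 : ℂ) ≠ 0 := mod_cast n.succ_ne_zero
  rw [complexTaylorCoeff, iteratedDeriv_fun_mul (by fun_prop) hg.contDiffAt,
    Finset.sum_range_succ', Finset.sum_range_succ', Finset.sum_eq_zero]
  · simp only [iteratedDeriv_one_sub, complexTaylorCoeff, Nat.factorial_succ]
    simp
    field_simp
    ring
  · intro i _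
    simp [iteratedDeriv_one_sub]

theorem hasSum_complexTaylorCoeff {f : ℂ → ℂ} (hf : DifferentiableOn ℂ f (Metric.ball 0 1))
    {w : ℂ} (hw : ‖w‖ < 1) : HasSum (fun n => complexTaylorCoeff f n * w ^ n) (f w) := by
  have h := Complex.hasSum_taylorSeries_on_ball hf (z := w) (by simpa using hw)
  refine h.congr_fun fun n => ?_
  simp only [complexTaylorCoeff, smul_eq_mul, sub_zero]
  ring

theorem hasFPowerSeriesOnBall_ofScalars_of_hasSum {c : ℕ → ℝ} {f : ℝ → ℝ}
    (h : ∀ z : ℝ, |z| < 1 → HasSum (fun n => c n * z ^ n) (f z)) :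
    HasFPowerSeriesOnBall f (.ofScalars ℝ c) 0 1 := by
  refine ⟨?_, by simp, ?_⟩
  · refine le_of_forall_lt_imp_le_of_dense fun r hr => ?_
    lift r to NNReal using hr.ne_top
    apply FormalMultilinearSeries.le_radius_of_summable
    have := (h r (by simpa using hr)).summable.norm
    simpa [norm_mul] using this
  · intro y hy
    rw [← ENNReal.coe_one, Metric.eball_coe, NNReal.coe_one, mem_ball_zero_iff] at hy
    simpa [mul_comm] using h y hy

/-- Uniqueness of power series; this is how the law of `L` is read off from its generating function
on `(-1, 1)`. -/
theorem eq_of_hasSum_mul_pow {c d : ℕ → ℝ} {f : ℝ → ℝ}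
    (hc : ∀ z : ℝ, |z| < 1 → HasSum (fun n => c n * z ^ n) (f z))
    (hd : ∀ z : ℝ, |z| < 1 → HasSum (fun n => d n * z ^ n) (f z)) : c = d := by
  have h := (hasFPowerSeriesOnBall_ofScalars_of_hasSum hc).hasFPowerSeriesAt
    |>.eq_formalMultilinearSeries (hasFPowerSeriesOnBall_ofScalars_of_hasSum hd).hasFPowerSeriesAt
  funext n
  simpa using congrArg (fun p => p.coeff n) h

theorem taylorCoeffZero_eq_of_hasSum {c : ℕ → ℝ} {f : ℝ → ℝ}
    (h : ∀ z : ℝ, |z| < 1 → HasSum (fun n => c n * z ^ n) (f z)) : taylorCoeffZero f = c := by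
  funext n
  have := (hasFPowerSeriesOnBall_ofScalars_of_hasSum h).factorial_smul 1 n
  rw [iteratedFDeriv_apply_eq_iteratedDeriv_mul_prod, Finset.prod_const_one, one_smul] at this
  rw [taylorCoeffZero, ← this, div_eq_iff (by positivity)]
  simp [mul_comm]

/-! ### The function `exp (s (1 - w) ^ (-1/2))` -/

/-- The function `exp (s (1 - w) ^ (-1/2))` on the complex plane. -/
noncomputable def expInvSqrt (s : ℝ) (w : ℂ) : ℂ :=
  Complex.exp (s * (1 - w) ^ (-1 / 2 : ℂ))

/-- The Taylor coefficients of `exp (s (1 - w) ^ (-1/2))`. -/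
noncomputable def expInvSqrtCoeff (s : ℝ) (n : ℕ) : ℝ :=
  (complexTaylorCoeff (expInvSqrt s) n).re

theorem one_sub_mem_slitPlane {w : ℂ} (hw : ‖w‖ < 1) : 1 - w ∈ Complex.slitPlane := by
  left
  have := (Complex.re_le_norm w).trans_lt hw
  simpa using this

theorem hasDerivAt_one_sub_cpow {w : ℂ} (hw : ‖w‖ < 1) :
    HasDerivAt (fun w : ℂ => (1 - w) ^ (-1 / 2 : ℂ))
      ((1 - w) ^ (-1 / 2 : ℂ) / (2 * (1 - w))) w := by
  have hs := one_sub_mem_slitPlane hw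
  have h0 : (1 - w) ≠ 0 := Complex.slitPlane_ne_zero hs
  have h : HasDerivAt (fun w : ℂ => (1 - w) ^ (-1 / 2 : ℂ))
      (-1 / 2 * (1 - w) ^ (-1 / 2 - 1 : ℂ) * -1) w :=
    ((hasDerivAt_id w).const_sub 1).cpow_const hs
  refine h.congr_deriv ?_
  rw [Complex.cpow_sub _ _ h0, Complex.cpow_one]
  field_simp

theorem hasDerivAt_expInvSqrt (s : ℝ) {w : ℂ} (hw : ‖w‖ < 1) :
    HasDerivAt (expInvSqrt s)
      (expInvSqrt s w * (s * ((1 - w) ^ (-1 / 2 : ℂ) / (2 * (1 - w))))) w :=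
  ((hasDerivAt_one_sub_cpow hw).const_mul (s : ℂ)).cexp

theorem differentiableOn_expInvSqrt (s : ℝ) :
    DifferentiableOn ℂ (expInvSqrt s) (Metric.ball 0 1) := fun _ hw =>
  (hasDerivAt_expInvSqrt s (by simpa using hw)).differentiableAt.differentiableWithinAt

theorem one_sub_cpow_sq {w : ℂ} (hw : ‖w‖ < 1) :
    (1 - w) * ((1 - w) ^ (-1 / 2 : ℂ)) ^ 2 = 1 := by
  have h0 : (1 - w) ≠ 0 := Complex.slitPlane_ne_zero (one_sub_mem_slitPlane hw)
  rw [← Complex.cpow_nat_mul]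
  norm_num [Complex.cpow_neg_one]
  exact mul_inv_cancel₀ h0

theorem eventually_norm_lt_one : ∀ᶠ w : ℂ in 𝓝 0, ‖w‖ < 1 := by
  filter_upwards [Metric.ball_mem_nhds (0 : ℂ) one_pos] with w hw
  simpa using hw

theorem analyticAt_of_forall_differentiableAt {f : ℂ → ℂ}
    (h : ∀ w : ℂ, ‖w‖ < 1 → DifferentiableAt ℂ f w) : AnalyticAt ℂ f 0 := by
  have : DifferentiableOn ℂ f (Metric.ball 0 1) := fun w hw =>
    (h w (by simpa using hw)).differentiableWithinAt
  exact this.analyticAt (Metric.ball_mem_nhds 0 one_pos)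

/-! ### The differential equation and the recurrence -/

/-- The auxiliary function `(1 - w) Φ' = (s / 2) (1 - w) ^ (-1/2) Φ` for `Φ = expInvSqrt s`. -/
noncomputable def expInvSqrtAux (s : ℝ) (w : ℂ) : ℂ :=
  s / 2 * ((1 - w) ^ (-1 / 2 : ℂ) * expInvSqrt s w)

theorem hasDerivAt_expInvSqrtAux (s : ℝ) {w : ℂ} (hw : ‖w‖ < 1) :
    HasDerivAt (expInvSqrtAux s)
      (s / 2 * ((1 - w) ^ (-1 / 2 : ℂ) / (2 * (1 - w)) * expInvSqrt s w +
        (1 - w) ^ (-1 / 2 : ℂ) *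
          (expInvSqrt s w * (s * ((1 - w) ^ (-1 / 2 : ℂ) / (2 * (1 - w))))))) w :=
  ((hasDerivAt_one_sub_cpow hw).mul (hasDerivAt_expInvSqrt s hw)).const_mul (s / 2 : ℂ)

theorem analyticAt_expInvSqrt (s : ℝ) : AnalyticAt ℂ (expInvSqrt s) 0 :=
  analyticAt_of_forall_differentiableAt fun _ hw => (hasDerivAt_expInvSqrt s hw).differentiableAt

theorem analyticAt_expInvSqrtAux (s : ℝ) : AnalyticAt ℂ (expInvSqrtAux s) 0 :=
  analyticAt_of_forall_differentiableAt fun _ hw =>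
    (hasDerivAt_expInvSqrtAux s hw).differentiableAt

theorem expInvSqrt_ode_first (s : ℝ) :
    (fun w => (1 - w) * deriv (expInvSqrt s) w) =ᶠ[𝓝 0] expInvSqrtAux s := by
  filter_upwards [eventually_norm_lt_one] with w hw
  have h0 : (1 - w) ≠ 0 := Complex.slitPlane_ne_zero (one_sub_mem_slitPlane hw)
  rw [(hasDerivAt_expInvSqrt s hw).deriv, expInvSqrtAux]
  field_simp

/-- Differentiating the auxiliary function produces the square of `(1 - w)^(-1/2)`, and the outer
factor `1 - w` cancels it. The fractional power disappears and only `s²` survives, so `s` and `-s`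
will obey the same recurrence. -/
theorem expInvSqrt_ode_second (s : ℝ) :
    (fun w => (1 - w) * ((1 - w) * deriv (expInvSqrtAux s) w - 1 / 2 * expInvSqrtAux s w))
      =ᶠ[𝓝 0] fun w => (s ^ 2 / 4 : ℂ) * expInvSqrt s w := by
  filter_upwards [eventually_norm_lt_one] with w hw
  have h0 : (1 - w) ≠ 0 := Complex.slitPlane_ne_zero (one_sub_mem_slitPlane hw)
  have h2 := one_sub_cpow_sq hw
  rw [(hasDerivAt_expInvSqrtAux s hw).deriv, expInvSqrtAux]
  set g := (1 - w) ^ (-1 / 2 : ℂ)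
  field_simp
  linear_combination (4 * s ^ 2 * expInvSqrt s w : ℂ) * h2

theorem complexTaylorCoeff_expInvSqrtAux_zero (s : ℝ) :
    complexTaylorCoeff (expInvSqrtAux s) 0 = s / 2 * Complex.exp s := by
  simp [complexTaylorCoeff_zero, expInvSqrtAux, expInvSqrt]

theorem complexTaylorCoeff_expInvSqrt_one (s : ℝ) :
    complexTaylorCoeff (expInvSqrt s) 1 = complexTaylorCoeff (expInvSqrtAux s) 0 := by
  have := complexTaylorCoeff_congr (expInvSqrt_ode_first s) 0
  have h2 := complexTaylorCoeff_deriv (expInvSqrt s) 0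
  rw [complexTaylorCoeff_zero] at this h2
  simp_all

theorem complexTaylorCoeff_expInvSqrt_add_two (s : ℝ) (n : ℕ) :
    (n + 2) * complexTaylorCoeff (expInvSqrt s) (n + 2) -
      (n + 1) * complexTaylorCoeff (expInvSqrt s) (n + 1) =
      complexTaylorCoeff (expInvSqrtAux s) (n + 1) := by
  rw [← complexTaylorCoeff_congr (expInvSqrt_ode_first s),
    complexTaylorCoeff_one_sub_mul (analyticAt_expInvSqrt s).deriv,
    complexTaylorCoeff_deriv, complexTaylorCoeff_deriv]
  push_cast
  ring

theorem complexTaylorCoeff_aux_succ (s : ℝ) (n : ℕ) :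
    complexTaylorCoeff
      (fun w => (1 - w) * deriv (expInvSqrtAux s) w - 1 / 2 * expInvSqrtAux s w) (n + 1) =
      (n + 2) * complexTaylorCoeff (expInvSqrtAux s) (n + 2) -
      (n + 3 / 2) * complexTaylorCoeff (expInvSqrtAux s) (n + 1) := by
  have ha := analyticAt_expInvSqrtAux s
  rw [complexTaylorCoeff_sub (by have := ha.deriv; fun_prop) (by fun_prop),
    complexTaylorCoeff_one_sub_mul ha.deriv, complexTaylorCoeff_const_mul,
    complexTaylorCoeff_deriv, complexTaylorCoeff_deriv]
  push_cast
  ring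

theorem complexTaylorCoeff_aux_zero (s : ℝ) :
    complexTaylorCoeff
      (fun w => (1 - w) * deriv (expInvSqrtAux s) w - 1 / 2 * expInvSqrtAux s w) 0 =
      complexTaylorCoeff (expInvSqrtAux s) 1 -
      1 / 2 * complexTaylorCoeff (expInvSqrtAux s) 0 := by
  have h := complexTaylorCoeff_deriv (expInvSqrtAux s) 0
  simp only [complexTaylorCoeff_zero] at h ⊢
  simp [h]

theorem complexTaylorCoeff_aux_sub (s : ℝ) (n : ℕ) :
    complexTaylorCoeff
      (fun w => (1 - w) * deriv (expInvSqrtAux s) w - 1 / 2 * expInvSqrtAux s w) (n + 1) -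
    complexTaylorCoeff
      (fun w => (1 - w) * deriv (expInvSqrtAux s) w - 1 / 2 * expInvSqrtAux s w) n =
    s ^ 2 / 4 * complexTaylorCoeff (expInvSqrt s) (n + 1) := by
  have ha := analyticAt_expInvSqrtAux s
  rw [← complexTaylorCoeff_one_sub_mul (by have := ha.deriv; fun_prop),
    complexTaylorCoeff_congr (expInvSqrt_ode_second s), complexTaylorCoeff_const_mul]

theorem complexTaylorCoeff_expInvSqrtAux_one (s : ℝ) :
    complexTaylorCoeff (expInvSqrtAux s) 1 = (s / 4 + s ^ 2 / 4) * Complex.exp s := by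
  have h := complexTaylorCoeff_congr (expInvSqrt_ode_second s) 0
  have h1 := complexTaylorCoeff_aux_zero s
  have h2 := complexTaylorCoeff_expInvSqrtAux_zero s
  rw [complexTaylorCoeff_zero] at h1
  rw [complexTaylorCoeff_zero, complexTaylorCoeff_zero] at h
  have h3 : expInvSqrt s 0 = Complex.exp s := by simp [expInvSqrt]
  rw [h3] at h
  simp only [sub_zero, one_mul] at h h1
  rw [h1, h2] at h
  linear_combination h

theorem expInvSqrtCoeff_one (s : ℝ) : expInvSqrtCoeff s 1 = s / 2 * Real.exp s := by
  rw [expInvSqrtCoeff, complexTaylorCoeff_expInvSqrt_one, complexTaylorCoeff_expInvSqrtAux_zero,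
    ← Complex.ofReal_re (s / 2 * Real.exp s)]
  push_cast
  rfl

theorem expInvSqrtCoeff_two (s : ℝ) :
    expInvSqrtCoeff s 2 = (3 * s / 8 + s ^ 2 / 8) * Real.exp s := by
  have h := complexTaylorCoeff_expInvSqrt_add_two s 0
  have h1 := complexTaylorCoeff_expInvSqrtAux_one s
  have h2 := complexTaylorCoeff_expInvSqrt_one s
  rw [complexTaylorCoeff_expInvSqrtAux_zero] at h2
  norm_num at h
  rw [h2, h1] at h
  rw [expInvSqrtCoeff, ← Complex.ofReal_re ((3 * s / 8 + s ^ 2 / 8) * Real.exp s)]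
  congr 1
  push_cast
  linear_combination h / 2

theorem expInvSqrtCoeff_recurrence (s : ℝ) (n : ℕ) :
    2 * n * (2 * n + 1) * expInvSqrtCoeff s n -
      (-s ^ 2 + 12 * n ^ 2 + 24 * n + 12) * expInvSqrtCoeff s (n + 1) +
      6 * (n + 2) * (2 * n + 3) * expInvSqrtCoeff s (n + 2) -
      4 * (n + 2) * (n + 3) * expInvSqrtCoeff s (n + 3) = 0 := by
  have key : 2 * n * (2 * n + 1) * complexTaylorCoeff (expInvSqrt s) n -
      (-s ^ 2 + 12 * n ^ 2 + 24 * n + 12) * complexTaylorCoeff (expInvSqrt s) (n + 1) +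
      6 * (n + 2) * (2 * n + 3) * complexTaylorCoeff (expInvSqrt s) (n + 2) -
      4 * (n + 2) * (n + 3) * complexTaylorCoeff (expInvSqrt s) (n + 3) = 0 := by
    have h3 := complexTaylorCoeff_expInvSqrt_add_two s (n + 1)
    have h2 := complexTaylorCoeff_expInvSqrt_add_two s n
    have k1 := complexTaylorCoeff_aux_succ s n
    have k := complexTaylorCoeff_aux_sub s n
    rw [k1] at k
    push_cast at h3
    -- The multipliers below are the weights of the auxiliary coefficients in `4 * k`, so that these
    -- cancel. The case `n = 0` is separate because the first-order relation then reads `φ_1 = ψ_0`,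
    -- with no preceding term.
    rcases n with _ | n
    · rw [complexTaylorCoeff_aux_zero] at k
      have h1 := complexTaylorCoeff_expInvSqrt_one s
      norm_num at *
      linear_combination (-8) * h3 + 10 * h2 - 2 * h1 - 4 * k
    · rw [complexTaylorCoeff_aux_succ] at k
      have h1 := complexTaylorCoeff_expInvSqrt_add_two s n
      push_cast at *
      linear_combination (-4) * (n + 3) * h3 + (8 * n + 18) * h2 - 2 * (2 * n + 3) * h1 - 4 * k
  have := congrArg Complex.re key
  simp only [expInvSqrtCoeff]
  rw [← Complex.zero_re, ← this]
  simp only [Complex.sub_re, Complex.add_re]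
  congr 1
  · congr 1
    · congr 1
      · rw [← Complex.re_ofReal_mul]; push_cast; rfl
      · rw [← Complex.re_ofReal_mul]; push_cast; rfl
    · rw [← Complex.re_ofReal_mul]; push_cast; rfl
  · rw [← Complex.re_ofReal_mul]; push_cast; rfl

theorem hasSum_expInvSqrtCoeff (s : ℝ) {w : ℝ} (hw : |w| < 1) :
    HasSum (fun n => expInvSqrtCoeff s n * w ^ n) (Real.exp (s / √(1 - w))) := by
  have h := hasSum_complexTaylorCoeff (differentiableOn_expInvSqrt s) (w := w) (by simpa using hw)
  have h1 : (0 : ℝ) ≤ 1 - w := by linarith [(abs_lt.1 hw).2]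
  have e : expInvSqrt s w = (Real.exp (s / √(1 - w)) : ℝ) := by
    have : ((1 : ℂ) - w) ^ (-1 / 2 : ℂ) = ((√(1 - w))⁻¹ : ℝ) := by
      rw [Real.sqrt_eq_rpow, ← Real.rpow_neg h1, Complex.ofReal_cpow h1]
      push_cast
      norm_num
    rw [expInvSqrt, this]
    push_cast
    rfl
  rw [e] at h
  convert! Complex.hasSum_re h using 1
  funext n
  rw [expInvSqrtCoeff, ← Complex.ofReal_pow, Complex.re_mul_ofReal]

/-- The exponent `-1/2` halves the argument, which then lies in `[-π/2, π/2]`; hence the power has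
nonnegative real part. -/
theorem norm_expInvSqrt_le_one {s : ℝ} (hs : s ≤ 0) {w : ℂ} (hw : ‖w‖ < 1) :
    ‖expInvSqrt s w‖ ≤ 1 := by
  rw [expInvSqrt, Complex.norm_exp, Complex.re_ofReal_mul]
  have hm := one_sub_mem_slitPlane hw
  have h0 : (1 - w) ≠ 0 := Complex.slitPlane_ne_zero hm
  have : 0 ≤ ((1 - w) ^ (-1 / 2 : ℂ)).re := by
    rw [Complex.cpow_def_of_ne_zero h0, Complex.exp_re]
    refine mul_nonneg (Real.exp_pos _).le (Real.cos_nonneg_of_mem_Icc ?_)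
    have e : (Complex.log (1 - w) * (-1 / 2 : ℂ)).im = -(1 - w).arg / 2 := by
      have : (-1 / 2 : ℂ) = ((-1 / 2 : ℝ) : ℂ) := by push_cast; rfl
      rw [this, Complex.im_mul_ofReal, Complex.log_im]
      ring
    rw [e]
    have h1 := Complex.neg_pi_lt_arg (1 - w)
    have h2 := Complex.arg_le_pi (1 - w)
    constructor <;> linarith
  rw [Real.exp_le_one_iff]
  nlinarith

theorem abs_expInvSqrtCoeff_le_one {s : ℝ} (hs : s ≤ 0) (n : ℕ) :
    |expInvSqrtCoeff s n| ≤ 1 := by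
  have key : ∀ r : ℝ, r ∈ Set.Ioo (0 : ℝ) 1 → |expInvSqrtCoeff s n| * r ^ n ≤ 1 := by
    intro r hr
    have hd : DifferentiableOn ℂ (expInvSqrt s) (Metric.closedBall 0 r) :=
      (differentiableOn_expInvSqrt s).mono (Metric.closedBall_subset_ball hr.2)
    have h := Complex.norm_iteratedDeriv_le_of_forall_mem_sphere_norm_le (C := 1) n hr.1
      (hd.diffContOnCl_ball subset_rfl) fun z hz => norm_expInvSqrt_le_one hs (by
        rw [mem_sphere_zero_iff_norm.1 hz]; exact hr.2)
    have h1 : |expInvSqrtCoeff s n| ≤ ‖complexTaylorCoeff (expInvSqrt s) n‖ :=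
      Complex.abs_re_le_norm _
    rw [complexTaylorCoeff, norm_div, Complex.norm_natCast] at h1
    have hr' := pow_pos hr.1 n
    have hf : (0 : ℝ) < n.factorial := by positivity
    rw [← le_div_iff₀ hr']
    refine h1.trans ?_
    rw [div_le_iff₀ hf]
    refine h.trans (le_of_eq ?_)
    ring
  -- Cauchy's estimate holds on every circle of radius `r < 1` with the same bound `1`, so `r` may
  -- tend to `1`.
  have ht : Tendsto (fun r : ℝ => |expInvSqrtCoeff s n| * r ^ n) (𝓝[<] 1)
      (𝓝 (|expInvSqrtCoeff s n| * 1 ^ n)) :=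
    (Continuous.tendsto (by fun_prop) 1).mono_left nhdsWithin_le_nhds
  have := le_of_tendsto ht (by
    filter_upwards [Ioo_mem_nhdsLT (zero_lt_one' ℝ)] with r hr using key r hr)
  simpa using this

/-! ### The saddle point integrand -/

/-- The integrand of the Cauchy formula for the coefficients of `exp (x (1 - w) ^ (-1/2))` on the
circle of radius `1 - y ^ 4`, normalized by its value at `θ = 0`. -/
noncomputable def saddleIntegrand (x y θ : ℝ) : ℂ :=
  Complex.exp (x * ((1 - (1 - y ^ 4) * Complex.exp (θ * Complex.I)) ^ (-1 / 2 : ℂ) - 1 / y ^ 2) -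
    x * θ / (2 * y ^ 6) * Complex.I)

theorem norm_circle_point {y : ℝ} (hy : y ^ 4 ≤ 1) (θ : ℝ) :
    ‖(1 - (y : ℂ) ^ 4) * Complex.exp (θ * Complex.I)‖ = 1 - y ^ 4 := by
  have : ((1 : ℂ) - (y : ℂ) ^ 4) = ((1 - y ^ 4 : ℝ) : ℂ) := by push_cast; rfl
  rw [norm_mul, Complex.norm_exp_ofReal_mul_I, this, Complex.norm_real, mul_one, Real.norm_eq_abs,
    abs_of_nonneg (by linarith)]

theorem continuous_saddleIntegrand (x : ℝ) {y : ℝ} (hy : 0 < y) (hy1 : y < 1) :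
    Continuous (saddleIntegrand x y) := by
  have h4 : y ^ 4 ≤ 1 := pow_le_one₀ hy.le hy1.le
  have h : Continuous fun θ : ℝ =>
      (1 - (1 - (y : ℂ) ^ 4) * Complex.exp (θ * Complex.I)) ^ (-1 / 2 : ℂ) := by
    refine Continuous.cpow (by fun_prop) continuous_const fun θ => one_sub_mem_slitPlane ?_
    rw [norm_circle_point h4]
    linarith [pow_pos hy 4]
  unfold saddleIntegrand
  fun_prop

/-- The difference quotient of the circle parametrization at the saddle point. -/
noncomputable def saddleShift (t y : ℝ) : ℂ :=
  (1 - y ^ 4) * (1 - Complex.exp ((y ^ 5 * t : ℝ) * Complex.I)) / y ^ 5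

/-- With `d = saddleShift t y`, the point of the circle satisfies `1 - w = y^4 (1 + y d)`. The
exponent contains `d / y`, so `d → -it` alone is not enough: the error must be `o(y)`. -/
theorem tendsto_saddleShift_add_div (t : ℝ) :
    Tendsto (fun y : ℝ => (saddleShift t y + t * Complex.I) / y) (𝓝[>] 0) (𝓝 0) := by
  have hb : Tendsto (fun y : ℝ => y ^ 3 * |t| + y ^ 4 * t ^ 2) (𝓝[>] 0) (𝓝 0) := by
    have : Continuous fun y : ℝ => y ^ 3 * |t| + y ^ 4 * t ^ 2 := by fun_prop
    simpa using (this.tendsto 0).mono_left nhdsWithin_le_nhds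
  have h5 : ∀ᶠ y : ℝ in 𝓝[>] 0, |y ^ 5 * t| < 1 := by
    have : Continuous fun y : ℝ => |y ^ 5 * t| := by fun_prop
    refine ((this.tendsto 0).mono_left nhdsWithin_le_nhds).eventually_lt_const ?_
    simp
  refine squeeze_zero_norm' ?_ hb
  filter_upwards [h5, Ioo_mem_nhdsGT (zero_lt_one' ℝ)] with y hyt hy
  have hy0 : (y : ℂ) ≠ 0 := mod_cast hy.1.ne'
  have hu := Complex.norm_exp_sub_one_sub_id_le (x := (y ^ 5 * t : ℝ) * Complex.I) (by
    rw [norm_mul, Complex.norm_I, Complex.norm_real, mul_one]; exact hyt.le)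
  set u := Complex.exp ((y ^ 5 * t : ℝ) * Complex.I) - 1 - (y ^ 5 * t : ℝ) * Complex.I with hu'
  have e : (saddleShift t y + t * Complex.I) / y =
      (y : ℂ) ^ 3 * (t * Complex.I) - ((1 - y ^ 4 : ℝ) : ℂ) * u / (y : ℂ) ^ 6 := by
    have : Complex.exp ((y ^ 5 * t : ℝ) * Complex.I) = u + 1 + (y ^ 5 * t : ℝ) * Complex.I := by
      rw [hu']; ring
    rw [saddleShift, this]
    push_cast
    field_simp
    ring
  rw [norm_mul, Complex.norm_I, Complex.norm_real, mul_one, Real.norm_eq_abs, sq_abs] at hu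
  have h4 : y ^ 4 ≤ 1 := pow_le_one₀ hy.1.le hy.2.le
  have hy6 : 0 < y ^ 6 := pow_pos hy.1 6
  rw [e]
  refine (norm_sub_le _ _).trans (add_le_add (le_of_eq ?_) ?_)
  · rw [norm_mul, norm_mul, norm_pow, Complex.norm_I, Complex.norm_real, Complex.norm_real,
      Real.norm_of_nonneg hy.1.le, Real.norm_eq_abs, mul_one]
  · rw [norm_div, norm_mul, norm_pow, Complex.norm_real, Complex.norm_real,
      Real.norm_of_nonneg hy.1.le, Real.norm_of_nonneg (by linarith), div_le_iff₀ hy6]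
    calc (1 - y ^ 4) * ‖u‖ ≤ 1 * (y ^ 5 * t) ^ 2 := by
          gcongr
          linarith [pow_pos hy.1 4]
      _ = y ^ 4 * t ^ 2 * y ^ 6 := by ring

theorem tendsto_ofReal_nhdsGT_zero : Tendsto (fun y : ℝ => (y : ℂ)) (𝓝[>] 0) (𝓝 0) := by
  have := (Complex.continuous_ofReal.tendsto 0).mono_left (nhdsWithin_le_nhds (s := Set.Ioi 0))
  simpa using this

theorem tendsto_saddleShift (t : ℝ) :
    Tendsto (saddleShift t) (𝓝[>] 0) (𝓝 (-(t * Complex.I))) := by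
  have h := ((tendsto_saddleShift_add_div t).mul tendsto_ofReal_nhdsGT_zero).sub_const
    (t * Complex.I)
  rw [mul_zero, zero_sub] at h
  refine h.congr' ?_
  filter_upwards [self_mem_nhdsWithin] with y hy
  have hy0 : (y : ℂ) ≠ 0 := mod_cast (ne_of_gt hy)
  field_simp
  ring

theorem ofReal_mul_cpow_of_pos {a : ℝ} (ha : 0 < a) {z : ℂ} (hz : z ≠ 0) (c : ℂ) :
    ((a : ℂ) * z) ^ c = (a : ℂ) ^ c * z ^ c := by
  have ha' : (a : ℂ) ≠ 0 := mod_cast ha.ne'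
  rw [Complex.cpow_def_of_ne_zero (mul_ne_zero ha' hz), Complex.cpow_def_of_ne_zero ha',
    Complex.cpow_def_of_ne_zero hz, Complex.log_ofReal_mul ha hz, Complex.ofReal_log ha.le, add_mul,
    Complex.exp_add]

/-- Second-order expansion of `(1 + yd)^(-1/2)` with its remainder in closed form. For `z = it` the
singular linear terms combine into `(d + z) / y`, and the factor of `d²` tends to `3/8` as `s → 1`.
-/
theorem inv_sqrt_taylor {s d y : ℂ} (hs : s ≠ 0) (hs1 : s + 1 ≠ 0) (hy : y ≠ 0)
    (h : s ^ 2 = 1 + y * d) (z : ℂ) :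
    (1 / y ^ 2 * s⁻¹ - 1 / y ^ 2) - z / (2 * y) =
      -((d + z) / y) / 2 + d ^ 2 * ((s + 2) / (2 * s * (s + 1) ^ 2)) := by
  have hd : d = (s ^ 2 - 1) / y := by rw [h]; field_simp; ring
  rw [hd]
  field_simp
  ring

theorem tendsto_saddleIntegrand (x t : ℝ) :
    Tendsto (fun y : ℝ => saddleIntegrand x y (y ^ 5 * t)) (𝓝[>] 0)
      (𝓝 ((Real.exp (-(3 * x / 8) * t ^ 2) : ℝ) : ℂ)) := by
  have hd := tendsto_saddleShift t
  have hz : Tendsto (fun y : ℝ => 1 + (y : ℂ) * saddleShift t y) (𝓝[>] 0) (𝓝 1) := by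
    simpa using (tendsto_ofReal_nhdsGT_zero.mul hd).const_add 1
  have hs : Tendsto (fun y : ℝ => (1 + (y : ℂ) * saddleShift t y) ^ (1 / 2 : ℂ)) (𝓝[>] 0)
      (𝓝 1) := by
    have := hz.cpow (tendsto_const_nhds (x := (1 / 2 : ℂ))) (by simp)
    simpa using this
  have hlim : Tendsto (fun y : ℝ => (x : ℂ) *
      (-((saddleShift t y + t * Complex.I) / y) / 2 + saddleShift t y ^ 2 *
        (((1 + (y : ℂ) * saddleShift t y) ^ (1 / 2 : ℂ) + 2) /
          (2 * (1 + (y : ℂ) * saddleShift t y) ^ (1 / 2 : ℂ) *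
            ((1 + (y : ℂ) * saddleShift t y) ^ (1 / 2 : ℂ) + 1) ^ 2)))) (𝓝[>] 0)
      (𝓝 ((x : ℂ) * (-0 / 2 + (-(t * Complex.I)) ^ 2 * ((1 + 2) / (2 * 1 * (1 + 1) ^ 2))))) := by
    refine Tendsto.const_mul _ (Tendsto.add ((tendsto_saddleShift_add_div t).neg.div_const 2)
      ((hd.pow 2).mul ((hs.add_const 2).div ((hs.const_mul 2).mul ((hs.add_const 1).pow 2)) ?_)))
    norm_num
  have hexp := (Complex.continuous_exp.tendsto _).comp hlim
  have e0 : Complex.exp ((x : ℂ) *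
      (-0 / 2 + (-(t * Complex.I)) ^ 2 * ((1 + 2) / (2 * 1 * (1 + 1) ^ 2)))) =
      ((Real.exp (-(3 * x / 8) * t ^ 2) : ℝ) : ℂ) := by
    push_cast
    congr 1
    linear_combination (3 * x * t ^ 2 / 8 : ℂ) * Complex.I_sq
  rw [e0] at hexp
  refine hexp.congr' ?_
  filter_upwards [Ioo_mem_nhdsGT (zero_lt_one' ℝ), hz.eventually_ne one_ne_zero,
    hs.eventually_ne one_ne_zero, (hs.add_const 1).eventually_ne (b₂ := 0) (by norm_num)]
    with y hy hz0 hs0 hs1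
  have hy0 : (y : ℂ) ≠ 0 := mod_cast hy.1.ne'
  have hsq : ((1 + (y : ℂ) * saddleShift t y) ^ (1 / 2 : ℂ)) ^ 2 = 1 + y * saddleShift t y := by
    rw [← Complex.cpow_nat_mul]
    norm_num
  have hcirc : 1 - (1 - (y : ℂ) ^ 4) * Complex.exp ((y ^ 5 * t : ℝ) * Complex.I) =
      ((y ^ 4 : ℝ) : ℂ) * (1 + y * saddleShift t y) := by
    rw [saddleShift]
    push_cast
    field_simp
    ring
  have hy4 : ((y ^ 4 : ℝ) : ℂ) ^ (-1 / 2 : ℂ) = 1 / (y : ℂ) ^ 2 := by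
    have : (-1 / 2 : ℂ) = ((-1 / 2 : ℝ) : ℂ) := by push_cast; rfl
    rw [this, ← Complex.ofReal_cpow (pow_nonneg hy.1.le 4), ← Real.rpow_natCast, ← Real.rpow_mul
      hy.1.le]
    norm_num
  have hcp : (1 - (1 - (y : ℂ) ^ 4) * Complex.exp ((y ^ 5 * t : ℝ) * Complex.I)) ^ (-1 / 2 : ℂ) =
      1 / (y : ℂ) ^ 2 * ((1 + (y : ℂ) * saddleShift t y) ^ (1 / 2 : ℂ))⁻¹ := by
    rw [hcirc, ofReal_mul_cpow_of_pos (pow_pos hy.1 4) hz0, hy4, ← Complex.cpow_neg]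
    norm_num
  simp only [Function.comp]
  rw [← inv_sqrt_taylor hs0 hs1 hy0 hsq, saddleIntegrand, hcp]
  congr 1
  push_cast
  field_simp

/-! ### Domination -/

theorem norm_one_sub_circle_point_sq (y θ : ℝ) :
    ‖1 - (1 - (y : ℂ) ^ 4) * Complex.exp (θ * Complex.I)‖ ^ 2 =
      y ^ 8 + 2 * (1 - y ^ 4) * (1 - Real.cos θ) := by
  have : (1 - (1 - (y : ℂ) ^ 4) * Complex.exp (θ * Complex.I)) =
      ((1 - (1 - y ^ 4) * Real.cos θ : ℝ) : ℂ) + ((-(1 - y ^ 4) * Real.sin θ : ℝ) : ℂ) *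
        Complex.I := by
    rw [Complex.exp_mul_I]
    push_cast
    ring
  rw [this, ← Complex.normSq_eq_norm_sq, Complex.normSq_add_mul_I]
  linear_combination (1 - y ^ 4) ^ 2 * Real.sin_sq_add_cos_sq θ

/-- By Bernoulli, `(1 - m/9)^4 (1 + m) ≥ (1 - 4m/9)(1 + m) ≥ 1` on `[0, 1]`. The constant `9` is
convenient, not sharp. -/
theorem le_one_sub_of_pow_four_mul_le {G τ m : ℝ} (hm0 : 0 ≤ m) (hm1 : m ≤ 1)
    (hmτ : m ≤ τ) (h : G ^ 4 * (1 + τ) ≤ 1) : G ≤ 1 - m / 9 := by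
  by_contra! hG
  have h1 : (1 - m / 9) ^ 4 < G ^ 4 := pow_lt_pow_left₀ hG (by linarith) (by norm_num)
  have h2 := one_add_mul_le_pow (a := -(m / 9)) (by linarith) 4
  have h3 : 1 - 4 * m / 9 ≤ (1 - m / 9) ^ 4 := by
    norm_num at h2
    rw [← sub_eq_add_neg] at h2
    linarith
  nlinarith [mul_nonneg hm0 (sub_nonneg.2 hm1)]

theorem exp_neg_le_div_one_add_sq {a t : ℝ} (ha : 0 < a) :
    Real.exp (-(a * t ^ 2)) ≤ (1 + 1 / a) * (1 + t ^ 2)⁻¹ := by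
  have h1 : 0 < 1 + a * t ^ 2 := by positivity
  calc Real.exp (-(a * t ^ 2)) ≤ (1 + a * t ^ 2)⁻¹ := by
        rw [Real.exp_neg]
        exact inv_anti₀ h1 (by linarith [Real.add_one_le_exp (a * t ^ 2)])
    _ ≤ (1 + 1 / a) * (1 + t ^ 2)⁻¹ := by
        rw [← div_eq_mul_inv, ← one_div, div_le_div_iff₀ h1 (by positivity)]
        have : (1 + 1 / a) * (1 + a * t ^ 2) = 1 + t ^ 2 + 1 / a + a * t ^ 2 := by
          field_simp
          ring
        rw [this]
        have : 0 < 1 / a := by positivity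
        nlinarith [mul_nonneg ha.le (sq_nonneg t)]

/-- The constant in the dominating function of the saddle point integrand. -/
noncomputable def saddleBound (x : ℝ) : ℝ :=
  (1 + 1 / (x * 2 / (9 * Real.pi ^ 2))) + 120 * (9 / x) ^ 5 * (1 + Real.pi ^ 2)

theorem norm_saddleIntegrand_le {x y t : ℝ} (hx : 0 < x) (hy : 0 < y) (hy4 : y ^ 4 ≤ 1 / 2)
    (ht : |y ^ 5 * t| ≤ Real.pi) :
    ‖saddleIntegrand x y (y ^ 5 * t)‖ ≤ saddleBound x * (1 + t ^ 2)⁻¹ := by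
  have hpi := Real.pi_pos
  have hy1 : y ≤ 1 := by
    by_contra! h
    linarith [one_lt_pow₀ h (n := 4) (by norm_num)]
  set w : ℂ := (1 - (y : ℂ) ^ 4) * Complex.exp ((y ^ 5 * t : ℝ) * Complex.I) with hw
  have hwn : ‖w‖ < 1 := by
    rw [hw, norm_circle_point (by linarith)]
    linarith [pow_pos hy 4]
  set g : ℂ := (1 - w) ^ (-1 / 2 : ℂ) with hg
  have hnorm : ‖saddleIntegrand x y (y ^ 5 * t)‖ = Real.exp (x * (g.re - 1 / y ^ 2)) := by
    rw [saddleIntegrand, Complex.norm_exp]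
    congr 1
    have e : (x * (g - 1 / y ^ 2) - x * (y ^ 5 * t : ℝ) / (2 * y ^ 6) * Complex.I : ℂ) =
        (x : ℂ) * (g - ((1 / y ^ 2 : ℝ) : ℂ)) -
          ((x * (y ^ 5 * t) / (2 * y ^ 6) : ℝ) : ℂ) * Complex.I := by push_cast; rfl
    rw [e, Complex.sub_re, Complex.re_ofReal_mul, Complex.sub_re, Complex.ofReal_re,
      Complex.re_ofReal_mul, Complex.I_re]
    ring
  set τ : ℝ := 2 / Real.pi ^ 2 * (y ^ 2 * t ^ 2) with hτ
  have hτ0 : 0 ≤ τ := by positivity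
  -- Uses `1 - cos θ ≥ 2θ²/π²` for `|θ| ≤ π`, and `2 (1 - y^4) ≥ 1`.
  have hlow : y ^ 8 * (1 + τ) ≤ ‖1 - w‖ ^ 2 := by
    rw [hw, norm_one_sub_circle_point_sq]
    have hc := Real.cos_le_one_sub_mul_cos_sq ht
    have h1 : 2 / Real.pi ^ 2 * (y ^ 5 * t) ^ 2 = y ^ 8 * τ := by rw [hτ]; ring
    rw [h1] at hc
    have h2 : 0 ≤ y ^ 8 * τ := by positivity
    nlinarith
  have hG : (y ^ 2 * ‖g‖) ^ 4 * (1 + τ) ≤ 1 := by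
    have h2 : ‖1 - w‖ * ‖g‖ ^ 2 = 1 := by
      rw [← norm_pow, ← norm_mul, one_sub_cpow_sq hwn, norm_one]
    calc (y ^ 2 * ‖g‖) ^ 4 * (1 + τ) = ‖g‖ ^ 4 * (y ^ 8 * (1 + τ)) := by ring
      _ ≤ ‖g‖ ^ 4 * ‖1 - w‖ ^ 2 := by gcongr
      _ = (‖1 - w‖ * ‖g‖ ^ 2) ^ 2 := by ring
      _ = 1 := by rw [h2, one_pow]
  have hbound : ∀ m : ℝ, 0 ≤ m → m ≤ 1 → m ≤ τ →
      x * (g.re - 1 / y ^ 2) ≤ -(x * m / (9 * y ^ 2)) := by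
    intro m h0 h1 h2
    have h3 := le_one_sub_of_pow_four_mul_le h0 h1 h2 hG
    have h4 : g.re ≤ (1 - m / 9) / y ^ 2 := by
      rw [le_div_iff₀ (by positivity), mul_comm]
      exact (mul_le_mul_of_nonneg_left (Complex.re_le_norm g) (by positivity)).trans h3
    calc x * (g.re - 1 / y ^ 2) ≤ x * ((1 - m / 9) / y ^ 2 - 1 / y ^ 2) := by gcongr
      _ = -(x * m / (9 * y ^ 2)) := by field_simp; ring
  have hinv : 0 < (1 + t ^ 2)⁻¹ := by positivity
  rw [hnorm, saddleBound, add_mul]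
  -- Near the saddle (`τ ≤ 1`, take `m = τ`) the bound is Gaussian in `t`. Away from it (`m = 1`) it
  -- is `exp (-x/(9y²))`. The fifth term of the exponential series, with `5! = 120`, turns this into
  -- a multiple of `y^10`, exactly what `|t| ≤ π / y^5` requires.
  rcases le_total τ 1 with h | h
  · have h1 := hbound τ hτ0 h le_rfl
    have e : x * τ / (9 * y ^ 2) = x * 2 / (9 * Real.pi ^ 2) * t ^ 2 := by
      rw [hτ]; field_simp
    rw [e] at h1
    have h2 := exp_neg_le_div_one_add_sq (t := t)
      (show 0 < x * 2 / (9 * Real.pi ^ 2) by positivity)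
    have h3 : 0 ≤ 120 * (9 / x) ^ 5 * (1 + Real.pi ^ 2) * (1 + t ^ 2)⁻¹ := by positivity
    linarith [Real.exp_le_exp.2 h1]
  · have h1 := hbound 1 zero_le_one le_rfl h
    have h2 := Real.pow_div_factorial_le_exp (x * 1 / (9 * y ^ 2)) (by positivity) 5
    have h3 : Real.exp (-(x * 1 / (9 * y ^ 2))) ≤ 120 * (9 / x) ^ 5 * y ^ 10 := by
      rw [Real.exp_neg, inv_le_comm₀ (Real.exp_pos _) (by positivity)]
      refine le_trans (le_of_eq ?_) h2
      norm_num [Nat.factorial]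
      field_simp
    have h4 : y ^ 10 * (1 + t ^ 2) ≤ 1 + Real.pi ^ 2 := by
      have h5 : y ^ 10 ≤ 1 := pow_le_one₀ hy.le hy1
      have h6 : (y ^ 5 * t) ^ 2 ≤ Real.pi ^ 2 := sq_le_sq' (abs_le.1 ht).1 (abs_le.1 ht).2
      nlinarith
    have h5 : y ^ 10 ≤ (1 + Real.pi ^ 2) * (1 + t ^ 2)⁻¹ := by
      rwa [← div_eq_mul_inv, le_div_iff₀ (by positivity)]
    have h6 : 0 ≤ (1 + 1 / (x * 2 / (9 * Real.pi ^ 2))) * (1 + t ^ 2)⁻¹ := by positivity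
    calc Real.exp (x * (g.re - 1 / y ^ 2)) ≤ 120 * (9 / x) ^ 5 * y ^ 10 :=
          (Real.exp_le_exp.2 h1).trans h3
      _ ≤ 120 * (9 / x) ^ 5 * ((1 + Real.pi ^ 2) * (1 + t ^ 2)⁻¹) := by gcongr
      _ ≤ _ := by linarith

/-! ### The Laplace method -/

theorem tendsto_integral_saddleIntegrand {x : ℝ} (hx : 0 < x) :
    Tendsto (fun y : ℝ => ∫ t : ℝ,
      (Set.Ioc (-Real.pi) Real.pi).indicator (saddleIntegrand x y) (y ^ 5 * t)) (𝓝[>] 0)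
      (𝓝 ((√(8 * Real.pi / (3 * x)) : ℝ) : ℂ)) := by
  have hI : ∫ t : ℝ, ((Real.exp (-(3 * x / 8) * t ^ 2) : ℝ) : ℂ) =
      ((√(8 * Real.pi / (3 * x)) : ℝ) : ℂ) := by
    rw [integral_complex_ofReal, integral_gaussian]
    congr 2
    field_simp
  rw [← hI]
  have h4 : ∀ᶠ y : ℝ in 𝓝[>] 0, y ^ 4 < 1 / 2 := by
    have : Continuous fun y : ℝ => y ^ 4 := by fun_prop
    refine ((this.tendsto 0).mono_left nhdsWithin_le_nhds).eventually_lt_const ?_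
    norm_num
  refine tendsto_integral_filter_of_dominated_convergence
    (fun t => saddleBound x * (1 + t ^ 2)⁻¹) ?_ ?_ (integrable_inv_one_add_sq.const_mul _) ?_
  · filter_upwards [Ioo_mem_nhdsGT (zero_lt_one' ℝ)] with y hy
    have h1 : Measurable ((Set.Ioc (-Real.pi) Real.pi).indicator (saddleIntegrand x y)) :=
      (continuous_saddleIntegrand x hy.1 hy.2).measurable.indicator measurableSet_Ioc
    exact (h1.comp (measurable_const_mul (y ^ 5))).aestronglyMeasurable
  · filter_upwards [self_mem_nhdsWithin, h4] with y hy hy4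
    refine ae_of_all _ fun t => ?_
    by_cases ht : y ^ 5 * t ∈ Set.Ioc (-Real.pi) Real.pi
    · rw [Set.indicator_of_mem ht]
      exact norm_saddleIntegrand_le hx hy hy4.le (abs_le.2 ⟨ht.1.le, ht.2⟩)
    · rw [Set.indicator_of_notMem ht, norm_zero, saddleBound]
      positivity
  · refine ae_of_all _ fun t => (tendsto_saddleIntegrand x t).congr' ?_
    have : Continuous fun y : ℝ => |y ^ 5 * t| := by fun_prop
    have h5 := ((this.tendsto 0).mono_left
      (nhdsWithin_le_nhds (s := Set.Ioi 0))).eventually_lt_const (u := Real.pi)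
        (by simpa using Real.pi_pos)
    filter_upwards [h5] with y hy
    have := abs_lt.1 hy
    rw [Set.indicator_of_mem (Set.mem_Ioc.2 ⟨this.1, this.2.le⟩)]

/-- The Cauchy formula for Taylor coefficients as a Fourier integral. -/
theorem complexTaylorCoeff_mul_pow_eq_integral {f : ℂ → ℂ} {r : ℝ} (hr : 0 < r)
    (hf : DifferentiableOn ℂ f (Metric.closedBall 0 r)) (n : ℕ) :
    2 * Real.pi * (complexTaylorCoeff f n * r ^ n) =
      ∫ θ in -Real.pi..Real.pi,
        f (r * Complex.exp (θ * Complex.I)) * Complex.exp (-(n * θ * Complex.I)) := by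
  have h := hf.circleIntegral_one_div_sub_center_pow_smul hr n
  have hr0 : (r : ℂ) ≠ 0 := mod_cast hr.ne'
  set F : ℝ → ℂ := fun θ =>
    f (r * Complex.exp (θ * Complex.I)) * Complex.exp (-(n * θ * Complex.I)) with hF
  have hper : Function.Periodic F (2 * Real.pi) := by
    intro θ
    simp only [hF]
    have e1 : Complex.exp ((θ + 2 * Real.pi : ℝ) * Complex.I) = Complex.exp (θ * Complex.I) := by
      rw [← Complex.exp_periodic (θ * Complex.I)]
      congr 1
      push_cast
      ring
    have e2 : ∀ φ : ℝ, Complex.exp (-(n * φ * Complex.I)) =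
        (Complex.exp (φ * Complex.I) ^ n)⁻¹ := by
      intro φ
      rw [← Complex.exp_nat_mul, ← Complex.exp_neg]
      ring_nf
    rw [e2, e2, e1]
  have e3 : ∮ z in C(0, r), (1 / (z - 0) ^ (n + 1)) • f z =
      ∫ θ in (0 : ℝ)..2 * Real.pi, Complex.I / r ^ n * F θ := by
    rw [circleIntegral]
    refine intervalIntegral.integral_congr fun θ _ => ?_
    simp only [deriv_circleMap, circleMap, zero_add, sub_zero, smul_eq_mul, hF]
    have e : Complex.exp (-(n * θ * Complex.I)) = (Complex.exp (θ * Complex.I) ^ n)⁻¹ := by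
      rw [← Complex.exp_nat_mul, ← Complex.exp_neg]
      ring_nf
    have := Complex.exp_ne_zero (θ * Complex.I)
    rw [e, mul_pow]
    field_simp
    ring
  rw [e3, intervalIntegral.integral_const_mul] at h
  -- Periodicity moves the saddle `θ = 0` to the interior of the interval.
  have e4 : ∫ θ in (0 : ℝ)..2 * Real.pi, F θ = ∫ θ in -Real.pi..Real.pi, F θ := by
    have := hper.intervalIntegral_add_eq 0 (-Real.pi)
    rw [zero_add] at this
    rw [this]
    congr 1
    ring
  rw [← e4, complexTaylorCoeff]
  have hn : (n.factorial : ℂ) ≠ 0 := mod_cast n.factorial_ne_zero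
  rw [smul_eq_mul] at h
  have hI := Complex.I_ne_zero
  field_simp at h ⊢
  linear_combination (-1 : ℂ) * h

/-- The hypothesis `hn` is the saddle point equation `(x/2) r (1 - r)^(-3/2) = n` at `r = 1 - y^4`
without its factor `r`. It makes the Fourier phase `nθ` equal to `xθ/(2y^6)`; the omitted factor is
harmless in the limit. -/
theorem expInvSqrt_mul_eq_integral_saddleIntegrand {x y : ℝ} (hy : 0 < y) (hy1 : y < 1) {n : ℕ}
    (hn : n * (2 * y ^ 6) = x) :
    2 * Real.pi * (complexTaylorCoeff (expInvSqrt x) n * ((1 - y ^ 4 : ℝ) : ℂ) ^ n) *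
      ((Real.exp (-(x / y ^ 2)) : ℝ) : ℂ) / (y : ℂ) ^ 5 =
      ∫ t : ℝ, (Set.Ioc (-Real.pi) Real.pi).indicator (saddleIntegrand x y) (y ^ 5 * t) := by
  have hr1 : y ^ 4 < 1 := pow_lt_one₀ hy.le hy1 (by norm_num)
  have hd : DifferentiableOn ℂ (expInvSqrt x) (Metric.closedBall 0 (1 - y ^ 4)) :=
    (differentiableOn_expInvSqrt x).mono
      (Metric.closedBall_subset_ball (by linarith [pow_pos hy 4]))
  have hy5 : 0 < y ^ 5 := pow_pos hy 5
  have hy0 : (y : ℂ) ≠ 0 := mod_cast hy.ne'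
  rw [complexTaylorCoeff_mul_pow_eq_integral (by linarith) hd n,
    Measure.integral_comp_mul_left, integral_indicator measurableSet_Ioc,
    ← intervalIntegral.integral_of_le (by linarith [Real.pi_pos]), abs_of_pos (inv_pos.2 hy5),
    ← intervalIntegral.integral_mul_const, div_eq_mul_inv, mul_comm, Complex.real_smul]
  congr 1
  · push_cast
    rfl
  · refine intervalIntegral.integral_congr fun θ _ => ?_
    simp only [expInvSqrt, saddleIntegrand]
    rw [Complex.ofReal_exp, ← Complex.exp_add, ← Complex.exp_add]
    congr 1
    rw [← hn]
    push_cast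
    field_simp
    ring

/-! ### Comparison with the explicit main term -/

theorem abs_log_one_sub_add_le {h : ℝ} (h1 : h ≤ 1 / 2) :
    |Real.log (1 - h) + h| ≤ 2 * h ^ 2 := by
  have hp : 0 < 1 - h := by linarith
  have h2 := Real.log_le_sub_one_of_pos hp
  have h3 := Real.one_sub_inv_le_log_of_pos hp
  have h4 : (1 - h)⁻¹ ≤ 1 + h + 2 * h ^ 2 := by
    rw [inv_le_iff_one_le_mul₀ hp]
    nlinarith [mul_nonneg (sq_nonneg h) (show 0 ≤ 1 - 2 * h by linarith)]
  rw [abs_le]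
  constructor <;> nlinarith

/-- The height parameter of the saddle point of the `n`-th coefficient. -/
noncomputable def saddleHeight (x : ℝ) (n : ℕ) : ℝ :=
  (x / (2 * n)) ^ (1 / 6 : ℝ)

theorem saddleHeight_pos {x : ℝ} (hx : 0 < x) {n : ℕ} (hn : 0 < n) : 0 < saddleHeight x n :=
  Real.rpow_pos_of_pos (by positivity) _

theorem mul_saddleHeight_pow {x : ℝ} (hx : 0 < x) {n : ℕ} (hn : 0 < n) :
    n * (2 * saddleHeight x n ^ 6) = x := by
  have h0 : 0 ≤ x / (2 * n) := by positivity
  rw [saddleHeight, ← Real.rpow_natCast, ← Real.rpow_mul h0]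
  norm_num
  field_simp

theorem tendsto_saddleHeight {x : ℝ} (hx : 0 < x) :
    Tendsto (saddleHeight x) atTop (𝓝[>] 0) := by
  refine tendsto_nhdsWithin_iff.2 ⟨?_, ?_⟩
  · have h : Tendsto (fun n : ℕ => x / (2 * (n : ℝ))) atTop (𝓝 0) :=
      tendsto_const_nhds.div_atTop (tendsto_natCast_atTop_atTop.const_mul_atTop two_pos)
    have := h.rpow_const (p := (1 / 6 : ℝ)) (Or.inr (by norm_num))
    rwa [Real.zero_rpow (by norm_num)] at this
  · filter_upwards [eventually_gt_atTop 0] with n hn using saddleHeight_pos hx hn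

/-- The factor that turns the `n`-th coefficient of `expInvSqrt x` into a saddle point integral. -/
noncomputable def saddleFactor (x : ℝ) (n : ℕ) : ℝ :=
  2 * Real.pi * (1 - saddleHeight x n ^ 4) ^ n * Real.exp (-(x / saddleHeight x n ^ 2)) /
    saddleHeight x n ^ 5

theorem tendsto_expInvSqrtCoeff_mul_saddleFactor {x : ℝ} (hx : 0 < x) :
    Tendsto (fun n => expInvSqrtCoeff x n * saddleFactor x n) atTop
      (𝓝 √(8 * Real.pi / (3 * x))) := by
  have h := (Complex.continuous_re.tendsto _).comp
    ((tendsto_integral_saddleIntegrand hx).comp (tendsto_saddleHeight hx))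
  rw [Complex.ofReal_re] at h
  refine h.congr' ?_
  filter_upwards [eventually_gt_atTop 0,
    (tendsto_saddleHeight hx).eventually (Ioo_mem_nhdsGT (zero_lt_one' ℝ))] with n hn hy
  simp only [Function.comp]
  rw [← expInvSqrt_mul_eq_integral_saddleIntegrand hy.1 hy.2 (mul_saddleHeight_pow hx hn),
    expInvSqrtCoeff, ← Complex.re_mul_ofReal, saddleFactor]
  congr 1
  push_cast
  ring

/-- The leading term of the coefficients of `expInvSqrt x`. -/
noncomputable def expInvSqrtMain (x : ℝ) (n : ℕ) : ℝ :=
  (x / 2) ^ (1 / 3 : ℝ) / √(3 * Real.pi) * (n : ℝ) ^ (-5 / 6 : ℝ) *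
    Real.exp (3 * (x / 2) ^ (2 / 3 : ℝ) * (n : ℝ) ^ (1 / 3 : ℝ))

theorem expInvSqrtMain_mul_saddleFactor {x : ℝ} (hx : 0 < x) {n : ℕ} (hn : 0 < n)
    (hy : saddleHeight x n < 1) :
    expInvSqrtMain x n * saddleFactor x n = √(8 * Real.pi / (3 * x)) *
      Real.exp (n * (Real.log (1 - saddleHeight x n ^ 4) + saddleHeight x n ^ 4)) := by
  have hn' : (0 : ℝ) < n := mod_cast hn
  have hx2 : 0 < x / 2 := by positivity
  have hy0 := saddleHeight_pos hx hn
  have hyn := mul_saddleHeight_pow hx hn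
  have hpow : ∀ k : ℕ, saddleHeight x n ^ k = (x / 2) ^ (k / 6 : ℝ) * (n : ℝ) ^ (-k / 6 : ℝ) := by
    intro k
    have e : x / (2 * n) = (x / 2) * (n : ℝ)⁻¹ := by field_simp
    rw [saddleHeight, e, ← Real.rpow_natCast, ← Real.rpow_mul (by positivity),
      Real.mul_rpow hx2.le (by positivity), Real.inv_rpow hn'.le, ← Real.rpow_neg hn'.le]
    congr 2 <;> ring
  have h1 : (x / 2) ^ (1 / 3 : ℝ) * (n : ℝ) ^ (-5 / 6 : ℝ) =
      (√(x / 2))⁻¹ * saddleHeight x n ^ 5 := by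
    rw [hpow, Real.sqrt_eq_rpow, ← Real.rpow_neg hx2.le, ← mul_assoc, ← Real.rpow_add hx2]
    norm_num
  have h2 : (x / 2) ^ (2 / 3 : ℝ) * (n : ℝ) ^ (1 / 3 : ℝ) = n * saddleHeight x n ^ 4 := by
    rw [hpow, mul_left_comm, ← Real.rpow_one_add' hn'.le (by norm_num)]
    norm_num
  have h3 : x / saddleHeight x n ^ 2 = 2 * (n * saddleHeight x n ^ 4) := by
    rw [div_eq_iff (by positivity)]
    linear_combination -hyn
  have hr : 0 < 1 - saddleHeight x n ^ 4 := by
    linarith [pow_lt_one₀ hy0.le hy (n := 4) (by norm_num)]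
  have h4 : (1 - saddleHeight x n ^ 4) ^ n =
      Real.exp (n * Real.log (1 - saddleHeight x n ^ 4)) := by
    rw [Real.exp_nat_mul, Real.exp_log hr]
  have h5 : √(8 * Real.pi / (3 * x)) = 2 * Real.pi * ((√(x / 2))⁻¹ / √(3 * Real.pi)) := by
    rw [Real.sqrt_eq_iff_mul_self_eq (by positivity) (by positivity)]
    have e1 : √(x / 2) ^ 2 = x / 2 := Real.sq_sqrt hx2.le
    have e2 : √(3 * Real.pi) ^ 2 = 3 * Real.pi := Real.sq_sqrt (by positivity)
    have e : 2 * Real.pi * ((√(x / 2))⁻¹ / √(3 * Real.pi)) *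
      (2 * Real.pi * ((√(x / 2))⁻¹ / √(3 * Real.pi))) =
        4 * Real.pi ^ 2 / (√(x / 2) ^ 2 * √(3 * Real.pi) ^ 2) := by field_simp; ring
    rw [e, e1, e2]
    field_simp
    ring
  have h6 : Real.exp (n * (Real.log (1 - saddleHeight x n ^ 4) + saddleHeight x n ^ 4)) =
      Real.exp (3 * (n * saddleHeight x n ^ 4)) *
        Real.exp (n * Real.log (1 - saddleHeight x n ^ 4)) *
          Real.exp (-(2 * (n * saddleHeight x n ^ 4))) := by
    rw [← Real.exp_add, ← Real.exp_add]
    ring_nf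
  rw [expInvSqrtMain, saddleFactor, h3, h4, h5, h6, mul_assoc 3, h2, div_mul_eq_mul_div, h1]
  field_simp

theorem tendsto_expInvSqrtMain_mul_saddleFactor {x : ℝ} (hx : 0 < x) :
    Tendsto (fun n => expInvSqrtMain x n * saddleFactor x n) atTop
      (𝓝 √(8 * Real.pi / (3 * x))) := by
  have hy0 : Tendsto (saddleHeight x) atTop (𝓝 0) :=
    (tendsto_saddleHeight hx).mono_right nhdsWithin_le_nhds
  have h4 : ∀ᶠ n in atTop, saddleHeight x n ^ 4 < 1 / 2 :=
    (hy0.pow 4).eventually_lt_const (by norm_num)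
  -- The logarithmic error is at most `2 n y^8 = x y²`, which tends to `0`.
  have hl : Tendsto (fun n : ℕ =>
      (n : ℝ) * (Real.log (1 - saddleHeight x n ^ 4) + saddleHeight x n ^ 4)) atTop (𝓝 0) := by
    have hb : Tendsto (fun n => x * saddleHeight x n ^ 2) atTop (𝓝 0) := by
      simpa using (hy0.pow 2).const_mul x
    refine squeeze_zero_norm' ?_ hb
    filter_upwards [h4, eventually_gt_atTop 0] with n hn hn0
    have := abs_log_one_sub_add_le hn.le
    rw [norm_mul, Real.norm_natCast, Real.norm_eq_abs]
    calc (n : ℝ) * _ ≤ n * (2 * (saddleHeight x n ^ 4) ^ 2) := by gcongr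
      _ = n * (2 * saddleHeight x n ^ 6) * saddleHeight x n ^ 2 := by ring
      _ = _ := by rw [mul_saddleHeight_pow hx hn0]
  have h := ((Real.continuous_exp.tendsto 0).comp hl).const_mul √(8 * Real.pi / (3 * x))
  rw [Real.exp_zero, mul_one] at h
  refine h.congr' ?_
  filter_upwards [hy0.eventually_lt_const one_pos, eventually_gt_atTop 0] with n hn hn0
  rw [expInvSqrtMain_mul_saddleFactor hx hn0 hn]
  rfl

/-- Coefficient and main term, multiplied by the same `saddleFactor`, converge to the same nonzero
constant. -/
theorem expInvSqrtCoeff_isEquivalent {x : ℝ} (hx : 0 < x) :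
    expInvSqrtCoeff x ~[atTop] expInvSqrtMain x := by
  have hL : √(8 * Real.pi / (3 * x)) ≠ 0 := by positivity
  have h1 := tendsto_expInvSqrtCoeff_mul_saddleFactor hx
  have h2 := tendsto_expInvSqrtMain_mul_saddleFactor hx
  have hne := h2.eventually_ne hL
  rw [isEquivalent_iff_tendsto_one (by
    filter_upwards [hne] with n hn using left_ne_zero_of_mul hn)]
  have h := h1.div h2 hL
  rw [div_self hL] at h
  refine h.congr' ?_
  filter_upwards [hne] with n hn
  have := left_ne_zero_of_mul hn
  have := right_ne_zero_of_mul hn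
  simp only [Pi.div_apply]
  field_simp

theorem tendsto_expInvSqrtMain {x : ℝ} (hx : 0 < x) :
    Tendsto (expInvSqrtMain x) atTop atTop := by
  have hc : 0 < 3 * (x / 2) ^ (2 / 3 : ℝ) := by positivity
  have hC : 0 < (x / 2) ^ (1 / 3 : ℝ) / √(3 * Real.pi) := by positivity
  have hm : Tendsto (fun n : ℕ => (n : ℝ) ^ (1 / 3 : ℝ)) atTop atTop :=
    (tendsto_rpow_atTop (by norm_num)).comp tendsto_natCast_atTop_atTop
  have h := ((tendsto_exp_mul_div_rpow_atTop (5 / 2) _ hc).comp hm).const_mul_atTop hC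
  refine h.congr fun n => ?_
  have hn : (0 : ℝ) ≤ n := n.cast_nonneg
  simp only [Function.comp, expInvSqrtMain]
  rw [← Real.rpow_mul hn, show (-5 / 6 : ℝ) = -(1 / 3 * (5 / 2)) by norm_num, Real.rpow_neg hn]
  ring

theorem tendsto_expInvSqrtCoeff {x : ℝ} (hx : 0 < x) :
    Tendsto (expInvSqrtCoeff x) atTop atTop :=
  (expInvSqrtCoeff_isEquivalent hx).symm.tendsto_atTop (tendsto_expInvSqrtMain hx)

/-! ### Probability generating functions -/

/-- Ensures that `ENNReal.ofReal` in `negBinMeasure` truncates nothing. -/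
theorem ringChoose_add_sub_one_nonneg {α : ℝ} (hα : 0 < α) (n : ℕ) :
    0 ≤ Ring.choose (α + n - 1) n := by
  have h := Ring.factorial_nsmul_multichoose_eq_ascPochhammer α n
  rw [Polynomial.ascPochhammer_smeval_eq_eval, Ring.multichoose_eq, nsmul_eq_mul] at h
  have h1 := (ascPochhammer_pos n α hα).le
  rw [← h] at h1
  exact nonneg_of_mul_nonneg_right h1 (by positivity)

theorem integral_pow_negBinMeasure {α p : ℝ} (hα : 0 < α) (hp : 0 < p) (hp1 : p < 1) {z : ℝ}
    (hz : |z| < 1) :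
    ∫ k, z ^ k ∂negBinMeasure α p = p ^ α * (1 / (1 - (1 - p) * z) ^ α) := by
  have hq : |(1 - p) * z| < 1 := by
    rw [abs_mul, abs_of_pos (by linarith)]
    nlinarith [abs_nonneg z]
  have hmem : (1 - p) * z ∈ Metric.eball (0 : ℝ) 1 := by
    rw [Metric.mem_eball, edist_dist, Real.dist_eq, sub_zero]
    exact ENNReal.ofReal_lt_one.2 hq
  have h := ((Real.one_div_one_sub_rpow_hasFPowerSeriesOnBall_zero α).hasSum hmem).mul_left (p ^ α)
  rw [zero_add] at h
  rw [negBinMeasure, integral_sum_dirac (by simp), ← h.tsum_eq]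
  congr 1
  funext n
  have := ringChoose_add_sub_one_nonneg hα n
  have h2 : 0 ≤ (1 - p) ^ n := pow_nonneg (by linarith) n
  rw [ENNReal.toReal_ofReal (by positivity), FormalMultilinearSeries.ofScalars_apply_eq,
    smul_eq_mul, smul_eq_mul, mul_pow]
  ring

theorem measurable_randomSum :
    Measurable fun q : ℕ × (ℕ → ℕ) => ∑ i ∈ Finset.range q.1, q.2 i := by
  refine measurable_from_prod_countable_right fun k => ?_
  exact Finset.measurable_fun_sum (Finset.range k) fun i _ =>
    measurable_pi_apply (X := fun _ : ℕ => ℕ) i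

theorem aemeasurable_aggregateLoss {Ω : Type*} [MeasurableSpace Ω] {μ : Measure Ω}
    {N : Ω → ℕ} {X : ℕ → Ω → ℕ}
    (hN : AEMeasurable N μ) (hX : ∀ i, AEMeasurable (X i) μ) : AEMeasurable (aggregateLoss N X) μ :=
  measurable_randomSum.comp_aemeasurable (hN.prodMk (aemeasurable_pi_lambda _ hX))

theorem abs_pow_le_one {z : ℝ} (hz : |z| < 1) (k : ℕ) : ‖z ^ k‖ ≤ 1 := by
  rw [norm_pow]
  exact pow_le_one₀ (norm_nonneg z) hz.le

section AggregateLoss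

variable {Ω : Type*} [MeasurableSpace Ω] {μ : Measure Ω} [IsProbabilityMeasure μ]

theorem hasSum_measureReal_mul_pow {L : Ω → ℕ} (hL : AEMeasurable L μ) {z : ℝ} (hz : |z| < 1) :
    HasSum (fun n => μ.real {ω | L ω = n} * z ^ n) (∫ ω, z ^ L ω ∂μ) := by
  have hP : IsProbabilityMeasure (μ.map L) := Measure.isProbabilityMeasure_map hL
  have hint : Integrable (fun n : ℕ => z ^ n) (μ.map L) :=
    Integrable.of_bound (C := 1) (measurable_of_countable _).aestronglyMeasurable
      (ae_of_all _ (abs_pow_le_one hz))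
  have h := integral_countable hint
  have e : ∀ n : ℕ, (μ.map L).real {n} = μ.real {ω | L ω = n} := fun n => by
    rw [map_measureReal_apply_of_aemeasurable hL (measurableSet_singleton n)]
    rfl
  rw [integral_map hL (measurable_of_countable _).aestronglyMeasurable] at h
  simp only [e, smul_eq_mul] at h
  rw [h]
  refine Summable.hasSum (Summable.of_norm_bounded (summable_geometric_of_abs_lt_one
    (r := |z|) (by rwa [abs_abs])) fun n => ?_)
  rw [norm_mul, norm_pow, Real.norm_eq_abs z, Real.norm_of_nonneg measureReal_nonneg]
  exact mul_le_of_le_one_left (by positivity) measureReal_le_one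

/-- By Fubini on the joint law of `N` and the claim sequence, fixing `N = k` gives the `k`-th power
of the claim generating function; averaging over the Poisson law sums an exponential series. -/
theorem integral_pow_aggregateLoss {lam : ℝ≥0} {ν : Measure ℕ} {N : Ω → ℕ} {X : ℕ → Ω → ℕ}
    (hN : HasLaw N (poissonMeasure lam) μ) (hX : ∀ i, HasLaw (X i) ν μ)
    (hXindep : iIndepFun X μ) (hNX : IndepFun N (fun ω i => X i ω) μ) {z : ℝ} (hz : |z| < 1) :
    ∫ ω, z ^ aggregateLoss N X ω ∂μ = Real.exp (lam * (∫ k, z ^ k ∂ν - 1)) := by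
  have hXm : AEMeasurable (fun ω i => X i ω) μ :=
    aemeasurable_pi_lambda _ fun i => (hX i).aemeasurable
  have hm : Measurable fun q : ℕ × (ℕ → ℕ) => z ^ (∑ i ∈ Finset.range q.1, q.2 i) :=
    (measurable_of_countable fun k : ℕ => z ^ k).comp measurable_randomSum
  have hprod := (indepFun_iff_map_prod_eq_prod_map_map hN.aemeasurable hXm).1 hNX
  have hP : IsProbabilityMeasure (μ.map fun ω i => X i ω) := Measure.isProbabilityMeasure_map hXm
  have h1 : ∫ ω, z ^ aggregateLoss N X ω ∂μ =
      ∫ q, z ^ (∑ i ∈ Finset.range q.1, q.2 i)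
        ∂((poissonMeasure lam).prod (μ.map fun ω i => X i ω)) := by
    rw [← hN.map_eq, ← hprod, integral_map (hN.aemeasurable.prodMk hXm) hm.aestronglyMeasurable]
    rfl
  have h2 : ∀ k : ℕ, ∫ x, z ^ (∑ i ∈ Finset.range k, x i) ∂(μ.map fun ω i => X i ω) =
      (∫ k, z ^ k ∂ν) ^ k := by
    intro k
    have hmk : Measurable fun x : ℕ → ℕ => z ^ (∑ i ∈ Finset.range k, x i) :=
      hm.comp measurable_prodMk_left
    rw [integral_map hXm hmk.aestronglyMeasurable]
    have h3 := (hXindep.precomp (Fin.val_injective (n := k))).integral_fun_prod_comp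
      (f := fun _ m => z ^ m) (fun i => (hX i).aemeasurable)
      (fun i => (measurable_of_countable _).aestronglyMeasurable)
    simp only [← Finset.prod_pow_eq_pow_sum, Finset.prod_range]
    refine h3.trans ?_
    have h4 : ∀ i : ℕ, ∫ ω, z ^ X i ω ∂μ = ∫ k, z ^ k ∂ν := fun i => by
      rw [← (hX i).map_eq, integral_map (hX i).aemeasurable
        (measurable_of_countable _).aestronglyMeasurable]
    simp [h4]
  rw [h1, integral_prod _ (Integrable.of_bound (C := 1) hm.aestronglyMeasurable
    (ae_of_all _ fun q => abs_pow_le_one hz _))]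
  simp only [h2]
  rw [integral_poissonMeasure, mul_sub, mul_one, sub_eq_neg_add, Real.exp_add,
    congrFun Real.exp_eq_exp_ℝ (lam * _), NormedSpace.exp_eq_tsum_div, ← tsum_mul_left]
  simp only [smul_eq_mul]
  congr 1
  funext k
  rw [mul_pow]
  ring

end AggregateLoss

theorem hasSum_pow_mul_expInvSqrtCoeff (s : ℝ) {q z : ℝ} (hq0 : 0 ≤ q) (hq1 : q < 1)
    (hz : |z| < 1) :
    HasSum (fun n => q ^ n * expInvSqrtCoeff s n * z ^ n) (Real.exp (s / √(1 - q * z))) := by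
  have hqz : |q * z| < 1 := by
    rw [abs_mul, abs_of_nonneg hq0]
    nlinarith [abs_nonneg z]
  refine (hasSum_expInvSqrtCoeff s hqz).congr_fun fun n => ?_
  rw [mul_pow]
  ring

theorem taylorCoeffZero_exp_neg_mul_sqrt {p : ℝ} (lam : ℝ) (hp : 0 < p) (hp1 : p < 1) :
    taylorCoeffZero (fun z => Real.exp (-(lam * √(p / (1 - (1 - p) * z))))) =
      fun n => (1 - p) ^ n * expInvSqrtCoeff (-(lam * √p)) n := by
  refine taylorCoeffZero_eq_of_hasSum fun z hz => ?_
  have h := hasSum_pow_mul_expInvSqrtCoeff (-(lam * √p)) (q := 1 - p) (by linarith) (by linarith) hz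
  rw [neg_div, mul_div_assoc, ← Real.sqrt_div hp.le] at h
  exact h

theorem measureReal_aggregateLoss_eq {Ω : Type*} [MeasurableSpace Ω] {μ : Measure Ω}
    [IsProbabilityMeasure μ] {lam : ℝ≥0} {p : ℝ} (hp : 0 < p) (hp1 : p < 1)
    {N : Ω → ℕ} {X : ℕ → Ω → ℕ} (hN : HasLaw N (poissonMeasure lam) μ)
    (hX : ∀ i, HasLaw (X i) (negBinMeasure (1 / 2) p) μ)
    (hXindep : iIndepFun X μ) (hNX : IndepFun N (fun ω i => X i ω) μ) (n : ℕ) :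
    μ.real {ω | aggregateLoss N X ω = n} =
      Real.exp (-lam) * ((1 - p) ^ n * expInvSqrtCoeff (lam * √p) n) := by
  refine congrFun (eq_of_hasSum_mul_pow (f := fun z => ∫ ω, z ^ aggregateLoss N X ω ∂μ)
    (c := fun n => μ.real {ω | aggregateLoss N X ω = n})
    (d := fun n => Real.exp (-lam) * ((1 - p) ^ n * expInvSqrtCoeff (lam * √p) n))
    (fun z hz => hasSum_measureReal_mul_pow
      (aemeasurable_aggregateLoss hN.aemeasurable fun i => (hX i).aemeasurable) hz)
    (fun z hz => ?_)) n
  have h := (hasSum_pow_mul_expInvSqrtCoeff (lam * √p) (q := 1 - p) (by linarith) (by linarith)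
    hz).mul_left (Real.exp (-lam))
  rw [integral_pow_aggregateLoss hN hX hXindep hNX hz,
    integral_pow_negBinMeasure (by norm_num) hp hp1 hz, ← Real.sqrt_eq_rpow, ← Real.sqrt_eq_rpow]
  rw [← Real.exp_add] at h
  convert! h using 1
  · funext n
    ring
  · congr 1
    ring

/-! ### Numerical stability -/

theorem solvesRecurrence_poissonNegBinCoeff_iff {lam p : ℝ} {c : ℕ → ℝ} :
    SolvesRecurrence (poissonNegBinCoeff lam p) c ↔ ∀ n : ℕ,
      2 * n * (2 * n + 1) * (1 - p) ^ 3 * c n -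
        (1 - p) ^ 2 * (-lam ^ 2 * p + 12 * n ^ 2 + 24 * n + 12) * c (n + 1) +
        6 * (n + 2) * (2 * n + 3) * (1 - p) * c (n + 2) -
        4 * (n + 2) * (n + 3) * c (n + 3) = 0 := by
  refine forall_congr' fun n => ?_
  rw [Fin.sum_univ_four]
  simp only [poissonNegBinCoeff, Matrix.cons_val, Fin.val_zero, Fin.val_one, Fin.val_two,
    add_zero]
  rw [show ((3 : Fin 4) : ℕ) = 3 from rfl]
  constructor <;> intro h <;> linear_combination h

theorem poissonNegBinCoeff_last_ne_zero (lam p : ℝ) (n : ℕ) :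
    poissonNegBinCoeff lam p (Fin.last 3) n ≠ 0 := by
  have : (0 : ℝ) < 4 * (n + 2) * (n + 3) := by positivity
  simpa [poissonNegBinCoeff, Fin.last] using
    (show (n + 2 : ℝ) ≠ 0 ∧ (n + 3 : ℝ) ≠ 0 from ⟨by positivity, by positivity⟩)

theorem solvesRecurrence_pow_mul_expInvSqrtCoeff {lam p s : ℝ} (hs : s ^ 2 = lam ^ 2 * p) :
    SolvesRecurrence (poissonNegBinCoeff lam p) fun n => (1 - p) ^ n * expInvSqrtCoeff s n := by
  rw [solvesRecurrence_poissonNegBinCoeff_iff]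
  intro n
  have h := expInvSqrtCoeff_recurrence s n
  rw [hs] at h
  linear_combination (1 - p) ^ (n + 3) * h

theorem solvesRecurrence_single_zero (lam p : ℝ) :
    SolvesRecurrence (poissonNegBinCoeff lam p) fun n => if n = 0 then 1 else 0 := by
  rw [solvesRecurrence_poissonNegBinCoeff_iff]
  intro n
  rcases n with _ | n <;> simp

theorem SolvesRecurrence.linear_combination {e : ℕ} {R : Fin (e + 1) → ℕ → ℝ} {c d : ℕ → ℝ}
    (hc : SolvesRecurrence R c) (hd : SolvesRecurrence R d) (a b : ℝ) :
    SolvesRecurrence R fun n => a * c n + b * d n := by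
  intro n
  have h : ∑ k : Fin (e + 1), R k n * (a * c (n + k) + b * d (n + k)) =
      a * ∑ k : Fin (e + 1), R k n * c (n + k) + b * ∑ k : Fin (e + 1), R k n * d (n + k) := by
    rw [Finset.mul_sum, Finset.mul_sum, ← Finset.sum_add_distrib]
    exact Finset.sum_congr rfl fun k _ => by ring
  rw [h, hc n, hd n]
  ring

theorem SolvesRecurrence.eq_of_initial {lam p : ℝ} {c d : ℕ → ℝ}
    (hc : SolvesRecurrence (poissonNegBinCoeff lam p) c)
    (hd : SolvesRecurrence (poissonNegBinCoeff lam p) d)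
    (h0 : c 0 = d 0) (h1 : c 1 = d 1) (h2 : c 2 = d 2) : c = d := by
  rw [solvesRecurrence_poissonNegBinCoeff_iff] at hc hd
  have key : ∀ n, c n = d n ∧ c (n + 1) = d (n + 1) ∧ c (n + 2) = d (n + 2) := by
    intro n
    induction n with
    | zero => exact ⟨h0, h1, h2⟩
    | succ n ih =>
      obtain ⟨e0, e1, e2⟩ := ih
      refine ⟨e1, e2, ?_⟩
      have hcn := hc n
      have hdn := hd n
      rw [← e0, ← e1, ← e2] at hdn
      have hne : (4 * (n + 2) * (n + 3) : ℝ) ≠ 0 := by positivity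
      exact mul_left_cancel₀ hne (by linarith)
  exact funext fun n => (key n).1

theorem solution_eq_combination {lam p : ℝ} (hlam : 0 < lam) (hp : 0 < p) (hp1 : p < 1)
    {c : ℕ → ℝ} (hc : SolvesRecurrence (poissonNegBinCoeff lam p) c) :
    ∃ u v w : ℝ, ∀ n, c n = u * ((1 - p) ^ n * expInvSqrtCoeff (lam * √p) n) +
      v * ((1 - p) ^ n * expInvSqrtCoeff (-(lam * √p)) n) + w * (if n = 0 then 1 else 0) := by
  have hx : 0 < lam * √p := by positivity
  have hx2 : (lam * √p) ^ 2 = lam ^ 2 * p := by rw [mul_pow, Real.sq_sqrt hp.le]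
  have hq : (1 - p) ≠ 0 := by linarith
  set x := lam * √p with hxd
  have hE := Real.exp_pos x
  set E := Real.exp x with hEd
  have h1 : expInvSqrtCoeff x 1 = x / 2 * E := expInvSqrtCoeff_one x
  have h2 : expInvSqrtCoeff x 2 = (3 * x / 8 + x ^ 2 / 8) * E := expInvSqrtCoeff_two x
  have h1' : expInvSqrtCoeff (-x) 1 = -x / 2 * E⁻¹ := by rw [expInvSqrtCoeff_one, Real.exp_neg]
  have h2' : expInvSqrtCoeff (-x) 2 = (-(3 * x) / 8 + x ^ 2 / 8) * E⁻¹ := by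
    rw [expInvSqrtCoeff_two, Real.exp_neg]
    ring
  set c1 := c 1 / (1 - p) with hc1
  set c2 := c 2 / (1 - p) ^ 2 with hc2
  -- The unit mass vanishes at indices `1` and `2`, so `u` and `v` solve a `2 × 2` system there,
  -- with determinant `x³/8`; then `w` adjusts index `0`.
  let u := (8 * c2 + (x * 2 - 6) * c1) / (2 * x ^ 2 * E)
  let v := (8 * c2 - (x * 2 + 6) * c1) * E / (2 * x ^ 2)
  let w := c 0 - u * expInvSqrtCoeff x 0 - v * expInvSqrtCoeff (-x) 0
  refine ⟨u, v, w, fun n => ?_⟩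
  have hs := ((solvesRecurrence_pow_mul_expInvSqrtCoeff (p := p) hx2).linear_combination
    (solvesRecurrence_pow_mul_expInvSqrtCoeff (s := -x) (p := p) (by rw [neg_sq, hx2]))
    u v).linear_combination (solvesRecurrence_single_zero lam p) 1 w
  refine (congrFun (hc.eq_of_initial hs ?_ ?_ ?_) n).trans (by simp only [one_mul])
  · simp [w]
  · have : c 1 = (1 - p) * c1 := by rw [hc1]; field_simp
    simp only [h1, h1', u, v, this]
    norm_num
    field_simp
    ring
  · have : c 2 = (1 - p) ^ 2 * c2 := by rw [hc2]; field_simp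
    simp only [h2, h2', u, v, this]
    norm_num
    field_simp
    ring

theorem expInvSqrtCoeff_neg_isLittleO {x : ℝ} (hx : 0 < x) :
    expInvSqrtCoeff (-x) =o[atTop] expInvSqrtCoeff x := by
  have h1 : expInvSqrtCoeff (-x) =O[atTop] fun _ => (1 : ℝ) :=
    IsBigO.of_bound 1 (Eventually.of_forall fun n => by
      simpa using abs_expInvSqrtCoeff_le_one (neg_nonpos.2 hx.le) n)
  refine h1.trans_isLittleO ?_
  rw [isLittleO_const_left]
  exact Or.inr (tendsto_norm_atTop_atTop.comp (tendsto_expInvSqrtCoeff hx))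

theorem isNumericallyStable_pow_mul_expInvSqrtCoeff {lam p : ℝ} (hlam : 0 < lam) (hp : 0 < p)
    (hp1 : p < 1) :
    IsNumericallyStable (poissonNegBinCoeff lam p)
      fun n => (1 - p) ^ n * expInvSqrtCoeff (lam * √p) n := by
  have hx : 0 < lam * √p := by positivity
  have hx2 : (lam * √p) ^ 2 = lam ^ 2 * p := by rw [mul_pow, Real.sq_sqrt hp.le]
  refine ⟨poissonNegBinCoeff_last_ne_zero lam p, solvesRecurrence_pow_mul_expInvSqrtCoeff hx2,
    fun c hc => ?_⟩
  obtain ⟨u, v, w, h⟩ := solution_eq_combination hlam hp hp1 hc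
  rw [funext h]
  refine ((isBigO_refl _ _).const_mul_left u |>.add
    (((isBigO_refl _ _).mul (expInvSqrtCoeff_neg_isLittleO hx).isBigO).const_mul_left v)).add ?_
  refine IsBigO.of_bound 0 ?_
  filter_upwards [eventually_ne_atTop 0] with n hn
  simp [hn]

theorem isNumericallyStable_const_mul {e : ℕ} {R : Fin (e + 1) → ℕ → ℝ} {a : ℕ → ℝ}
    (h : IsNumericallyStable R a) {k : ℝ} (hk : k ≠ 0) :
    IsNumericallyStable R fun n => k * a n := by
  refine ⟨h.1, ?_, fun c hc => (h.2.2 c hc).const_mul_right hk⟩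
  simpa using h.2.1.linear_combination h.2.1 k 0

theorem const_mul_pow_mul_expInvSqrtMain {lam p : ℝ} (hlam : 0 < lam) (hp : 0 < p) (n : ℕ) :
    Real.exp (-lam) * ((1 - p) ^ n * expInvSqrtMain (lam * √p) n) =
      lam ^ (1 / 3 : ℝ) * p ^ (1 / 6 : ℝ) / (2 ^ (1 / 3 : ℝ) * √(3 * Real.pi)) *
        (1 - p) ^ n * (n : ℝ) ^ (-5 / 6 : ℝ) *
        Real.exp (3 * p ^ (1 / 3 : ℝ) * (lam / 2) ^ (2 / 3 : ℝ) * (n : ℝ) ^ (1 / 3 : ℝ)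
          - lam) := by
  have h1 : (lam * √p / 2) ^ (1 / 3 : ℝ) =
      lam ^ (1 / 3 : ℝ) * p ^ (1 / 6 : ℝ) / 2 ^ (1 / 3 : ℝ) := by
    rw [Real.div_rpow (by positivity) two_pos.le, Real.mul_rpow hlam.le (by positivity),
      Real.sqrt_eq_rpow, ← Real.rpow_mul hp.le]
    norm_num
  have h2 : (lam * √p / 2) ^ (2 / 3 : ℝ) = p ^ (1 / 3 : ℝ) * (lam / 2) ^ (2 / 3 : ℝ) := by
    rw [mul_comm lam, mul_div_assoc, Real.mul_rpow (by positivity) (by positivity),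
      Real.sqrt_eq_rpow, ← Real.rpow_mul hp.le]
    norm_num
  rw [expInvSqrtMain, h1, h2, Real.exp_sub, Real.exp_neg, div_div, ← mul_assoc 3]
  ring

theorem mainTheorem4 {Ω : Type*} [MeasurableSpace Ω] (μ : Measure Ω) [IsProbabilityMeasure μ]
    (lam : ℝ≥0) (hlam : 0 < lam) (p : ℝ) (hp : 0 < p) (hp1 : p < 1)
    (N : Ω → ℕ) (X : ℕ → Ω → ℕ)
    (hN : HasLaw N (poissonMeasure lam) μ)
    (hX : ∀ i, HasLaw (X i) (negBinMeasure (1 / 2) p) μ)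
    (hXindep : iIndepFun X μ)
    (hNX : IndepFun N (fun ω i => X i ω) μ)
    (a : ℕ → ℝ) (ha : ∀ n, a n = μ.real {ω | aggregateLoss N X ω = n}) :
    IsNumericallyStable (poissonNegBinCoeff lam p) a ∧
    a ~[atTop] (fun n : ℕ =>
      (lam : ℝ) ^ (1 / 3 : ℝ) * p ^ (1 / 6 : ℝ) / (2 ^ (1 / 3 : ℝ) * √(3 * Real.pi)) *
        (1 - p) ^ n * (n : ℝ) ^ (-5 / 6 : ℝ) *
        Real.exp (3 * p ^ (1 / 3 : ℝ) * ((lam : ℝ) / 2) ^ (2 / 3 : ℝ) * (n : ℝ) ^ (1 / 3 : ℝ)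
          - lam)) ∧
    taylorCoeffZero (fun z => Real.exp (-(lam * √(p / (1 - (1 - p) * z))))) =o[atTop] a := by
  have hlam' : (0 : ℝ) < lam := hlam
  have hx : 0 < lam * √p := by positivity
  have hE : Real.exp (-lam) ≠ 0 := (Real.exp_pos _).ne'
  have hae : a = fun n => Real.exp (-lam) * ((1 - p) ^ n * expInvSqrtCoeff (lam * √p) n) :=
    funext fun n => (ha n).trans (measureReal_aggregateLoss_eq hp hp1 hN hX hXindep hNX n)
  rw [hae]
  refine ⟨isNumericallyStable_const_mul
    (isNumericallyStable_pow_mul_expInvSqrtCoeff hlam' hp hp1) hE, ?_, ?_⟩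
  · simp only [← const_mul_pow_mul_expInvSqrtMain hlam' hp]
    exact IsEquivalent.refl.mul (IsEquivalent.refl.mul (expInvSqrtCoeff_isEquivalent hx))
  · rw [taylorCoeffZero_exp_neg_mul_sqrt lam hp hp1, isLittleO_const_mul_right_iff hE]
    exact (isBigO_refl _ _).mul_isLittleO (expInvSqrtCoeff_neg_isLittleO hx)
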